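/- Let $H_n=\mathbb C^n\times\mathbb R$ be the Heisenberg group with coordinates $(z,t)$, $z_\beta=x_\beta+iy_\beta$, contact form $\Theta=dt+\sum_\beta(x_\beta\,dy_\beta-y_\beta\,dx_\beta)$, contact bundle $\xi=\ker\Theta$ with left invariant frame $e_\beta=\partial_{x_\beta}+y_\beta\partial_t$, $e_{n+\beta}=\partial_{y_\beta}-x_\beta\partial_t$, complex structure $Je_\beta=e_{n+\beta}$, $Je_{n+\beta}=-e_\beta$ on $\xi$, and $T=\partial_t$. Let $\nabla$ be its pseudohermitian connection (for which $Z_\beta=\tfrac12(e_\beta-ie_{n+\beta})$ is parallel) and $\langle\,,\rangle$ the Levi metric (for which $Z_\beta$ is unitary). A Heisenberg rigid motion is a diffeomorphism of $H_n$ preserving $\Theta$ and $J$. A pseudohermitian submanifold of $H_n$ of CR dimension $m$ $(1\le m\le n)$ is a smooth $(2m+1)$-manifold $M$ with an immersion $\iota$ into $H_n$ (e.g. the inclusion of an embedded submanifold) such that $\hat\theta=\iota^*\Theta$ vanishes nowhere and $\hat\xi=\ker\hat\theta=TM\cap\xi$ is $J$-invariant; put $\hat J=J|_{\hat\xi}$.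 Let $\hat\xi_{1,0}$ be the bundle of $(1,0)$-vectors of $M$, and $\hat\xi^\perp_{1,0}$ its Levi-orthogonal complement in $\xi_{1,0}$, identified with the real normal bundle $\hat\xi^\perp\subset\xi$ by $V\mapsto\frac12(V-iJV)$. The fundamental vector field $\nu$ is the unique section of $\hat\xi^\perp$ with $T+\nu\in TM$; the normal connection $\nabla^\perp$ on $\hat\xi^\perp_{1,0}$ and the second fundamental form $II:\hat\xi_{1,0}\times\hat\xi_{1,0}\to\hat\xi^\perp_{1,0}$ are defined by $\nabla^\perp_XV=(\nabla_XV)^\perp$ and $II(X,Y)=(\nabla_YX)^\perp$ ($X$ extended to a section of $\hat\xi_{1,0}$). **Theorem A.** Let $M$ and $N$ be simply connected pseudohermitian submanifolds of $H_n$ with the same CR dimension $m$, with data $(\hat\theta,\hat J,II,\nabla^\perp,\nu)$ and $(\tilde\theta,\tilde J,\widetilde{II},\tilde\nabla^\perp,\tilde\nu)$, and let $\varphi:M\to N$ be a diffeomorphism. The following are equivalent. 1. $M$ and $N$ have, via $\varphi$, the same induced pseudohermitian structure, second fundamental form, normal connection and fundamental vector field: there is a complex vector bundle isomorphism $F:\hat\xi^\perp_{1,0}\to\tilde\xi^\perp_{1,0}$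 covering $\varphi$ and preserving the Hermitian metrics, such that $\varphi^*\tilde\theta=\hat\theta$ and $\varphi_*\circ\hat J=\tilde J\circ\varphi_*$ on $\hat\xi$; $\langle\widetilde{II}(\varphi_*X,\varphi_*Y),FV\rangle=\langle II(X,Y),V\rangle$ for $X,Y\in\hat\xi_{1,0}$, $V\in\hat\xi^\perp_{1,0}$; $F(\nabla^\perp_XV)=\tilde\nabla^\perp_{\varphi_*X}(FV)$ for $X\in TM$ and local sections $V$ of $\hat\xi^\perp_{1,0}$; and $F\nu=\tilde\nu$. 2. There is a Heisenberg rigid motion $\Phi$ of $H_n$ with $\Phi|_M=\varphi$ (that is, $\Phi$ composed with the immersion of $M$ equals the immersion of $N$ composed with $\varphi$). In particular, if $M$ and $N$ have the same four invariants, then they differ by a Heisenberg rigid motion. -/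

import Mathlib

open scoped Manifold ContDiff

noncomputable section

/-- Complex `n`-space with its standard Hermitian product. -/
abbrev CVec (n : ℕ) := EuclideanSpace ℂ (Fin n)

/-- The manifold underlying the Heisenberg group `H_n = ℂⁿ × ℝ`, with coordinates `(z, t)`,
`z_β = x_β + i y_β`. All its tangent spaces are identified with `ℂⁿ × ℝ` by these coordinates. -/
abbrev Heis (n : ℕ) := CVec n × ℝ

namespace Heis

/-- The standard contact form `Θ = dt + ∑ (x_β dy_β - y_β dx_β)`, at the point `p`,
evaluated on the tangent vector `X`. -/
def contactForm {n : ℕ} (p X : Heis n) : ℝ :=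
  X.2 + ∑ β, ((p.1 β).re * (X.1 β).im - (p.1 β).im * (X.1 β).re)

/-- For `v = a + i b ∈ ℂⁿ`, the horizontal vector `∑ (a_β e_β + b_β e_{n+β})` at `p`, where
`e_β = ∂/∂x_β + y_β ∂/∂t` and `e_{n+β} = ∂/∂y_β - x_β ∂/∂t` is the left invariant frame of
`ξ = ker Θ`. Its `(1,0)`-part is `∑ v_β Z_β`, where `Z_β = (e_β - i e_{n+β}) / 2`. -/
def hlift {n : ℕ} (p : Heis n) (v : CVec n) : Heis n :=
  (v, ∑ β, ((p.1 β).im * (v β).re - (p.1 β).re * (v β).im))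

/-- The complex structure of `ξ = ker Θ`: `J e_β = e_{n+β}`, `J e_{n+β} = - e_β`
(only used on horizontal vectors). -/
def J {n : ℕ} (p X : Heis n) : Heis n := hlift p (Complex.I • X.1)

/-- The vector field `T = ∂/∂t`. -/
def T (n : ℕ) : Heis n := (0, 1)

/-- Heisenberg rigid motions, that is, the elements of `PSH(n)`: the diffeomorphisms of `H_n`
that preserve the contact form `Θ` and the CR structure `J`. -/
structure IsRigidMotion {n : ℕ}
    (Φ : Diffeomorph 𝓘(ℝ, Heis n) 𝓘(ℝ, Heis n) (Heis n) (Heis n) ∞) : Prop where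
  contactForm_eq : ∀ p X : Heis n, contactForm (Φ p) (fderiv ℝ Φ p X) = contactForm p X
  map_J : ∀ p X : Heis n, contactForm p X = 0 →
    fderiv ℝ Φ p (J p X) = J (Φ p) (fderiv ℝ Φ p X)

theorem hlift_add {n : ℕ} (p : Heis n) (v w : CVec n) :
    hlift p (v + w) = hlift p v + hlift p w := by
  refine Prod.ext rfl ?_
  simp only [hlift, Prod.snd_add, ← Finset.sum_add_distrib]
  refine Finset.sum_congr rfl fun β _ => ?_
  simp
  ring

theorem hlift_smul {n : ℕ} (p : Heis n) (c : ℝ) (v : CVec n) :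
    hlift p (c • v) = c • hlift p v := by
  refine Prod.ext rfl ?_
  simp only [hlift, Prod.smul_snd, smul_eq_mul, Finset.mul_sum]
  refine Finset.sum_congr rfl fun β _ => ?_
  simp
  ring

theorem contactForm_hlift {n : ℕ} (p : Heis n) (v : CVec n) : contactForm p (hlift p v) = 0 := by
  simp only [contactForm, hlift, ← Finset.sum_add_distrib]
  exact Finset.sum_eq_zero fun β _ => by ring

theorem eq_hlift_add {n : ℕ} (p X : Heis n) :
    X = hlift p X.1 + contactForm p X • T n := by
  refine Prod.ext (by simp [hlift, T]) ?_
  simp only [hlift, contactForm, T, Prod.snd_add, Prod.smul_snd, smul_eq_mul, mul_one]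
  rw [add_left_comm, ← Finset.sum_add_distrib, Finset.sum_eq_zero, add_zero]
  exact fun β _ => by ring

theorem contactForm_sub {n : ℕ} (p X Y : Heis n) :
    contactForm p (X - Y) = contactForm p X - contactForm p Y := by
  simp only [contactForm, Prod.snd_sub, Prod.fst_sub]
  rw [add_sub_add_comm, ← Finset.sum_sub_distrib]
  congr 1
  refine Finset.sum_congr rfl fun β _ => ?_
  simp
  ring

theorem contactForm_smul {n : ℕ} (p X : Heis n) (c : ℝ) :
    contactForm p (c • X) = c * contactForm p X := by
  simp only [contactForm, Prod.smul_snd, Prod.smul_fst, mul_add, Finset.mul_sum, smul_eq_mul]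
  congr 1
  refine Finset.sum_congr rfl fun β _ => ?_
  simp
  ring

end Heis

open Heis

/-- A pseudohermitian submanifold of `H_n` of CR dimension `m`: a smooth manifold `M` of dimension
`2m+1` with an immersion `ι` into `H_n` such that `TM` is nowhere contained in `ξ` and `TM ∩ ξ` is
`J`-invariant. The induced contact form is `ι^*Θ`, and the induced CR structure is the restriction
of `J` to `TM ∩ ξ` (a `J`-invariant subspace of `ξ`, of dimension `2m`). Integrability and
nondegeneracy of this structure are inherited from `H_n`. -/
structure PseudohermitianSubmanifold (m n : ℕ) (M : Type*) [TopologicalSpace M]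
    [ChartedSpace (EuclideanSpace ℝ (Fin (2 * m + 1))) M]
    [IsManifold (𝓡 (2 * m + 1)) ∞ M] where
  /-- the immersion -/
  toFun : M → Heis n
  smooth : ContMDiff (𝓡 (2 * m + 1)) 𝓘(ℝ, Heis n) ∞ toFun
  immersion : ∀ p, Function.Injective (mfderiv (𝓡 (2 * m + 1)) 𝓘(ℝ, Heis n) toFun p)
  transverse : ∀ p, ∃ X : TangentSpace (𝓡 (2 * m + 1)) p,
    contactForm (toFun p) (mfderiv (𝓡 (2 * m + 1)) 𝓘(ℝ, Heis n) toFun p X) ≠ 0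
  J_invariant : ∀ p, ∀ X : TangentSpace (𝓡 (2 * m + 1)) p,
    contactForm (toFun p) (mfderiv (𝓡 (2 * m + 1)) 𝓘(ℝ, Heis n) toFun p X) = 0 →
    ∃ Y : TangentSpace (𝓡 (2 * m + 1)) p,
      mfderiv (𝓡 (2 * m + 1)) 𝓘(ℝ, Heis n) toFun p Y =
        J (toFun p) (mfderiv (𝓡 (2 * m + 1)) 𝓘(ℝ, Heis n) toFun p X)

namespace PseudohermitianSubmanifold

variable {m n : ℕ} {M : Type*} [TopologicalSpace M]
  [ChartedSpace (EuclideanSpace ℝ (Fin (2 * m + 1))) M] [IsManifold (𝓡 (2 * m + 1)) ∞ M]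

instance : CoeFun (PseudohermitianSubmanifold m n M) (fun _ => M → Heis n) := ⟨toFun⟩

variable (S : PseudohermitianSubmanifold m n M)

/-- The differential of the immersion at `p`, with values in the coordinate space `ℂⁿ × ℝ`. -/
def d (p : M) : TangentSpace (𝓡 (2 * m + 1)) p →L[ℝ] Heis n :=
  mfderiv (𝓡 (2 * m + 1)) 𝓘(ℝ, Heis n) S p

/-- The induced contact form `ι^*Θ`. -/
def theta (p : M) (X : TangentSpace (𝓡 (2 * m + 1)) p) : ℝ := contactForm (S p) (S.d p X)

/-- The induced CR structure on `ker (ι^*Θ)`: the vector `Y` with `ι_* Y = J (ι_* X)`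
(only used on vectors `X` in `ker (ι^*Θ)`, where `Y` exists; it is unique). -/
def inducedJ (p : M) (X : TangentSpace (𝓡 (2 * m + 1)) p) : TangentSpace (𝓡 (2 * m + 1)) p :=
  Function.invFun (S.d p) (J (S p) (S.d p X))

theorem d_inducedJ (p : M) (X : TangentSpace (𝓡 (2 * m + 1)) p) (hX : S.theta p X = 0) :
    S.d p (S.inducedJ p X) = J (S p) (S.d p X) :=
  Function.invFun_eq (S.J_invariant p X hX)

/-- The bundle of `(1,0)`-vectors of `M`, a complex subbundle of the `(1,0)`-bundle of `H_n`, which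
is trivialized by the left invariant frame `Z_β`: the vector `∑ v_β Z_β` belongs to it
iff the real vector `∑ (Re v_β e_β + Im v_β e_{n+β})` is tangent to `M`. -/
def holTangent (p : M) : Submodule ℂ (CVec n) where
  carrier := {v | ∃ X : TangentSpace (𝓡 (2 * m + 1)) p, S.d p X = hlift (S p) v}
  add_mem' := by
    rintro v w ⟨X, hX⟩ ⟨Y, hY⟩
    exact ⟨X + Y, by rw [map_add, hX, hY, hlift_add]⟩
  zero_mem' := ⟨0, by rw [map_zero]; exact Prod.ext rfl (by simp [hlift])⟩
  smul_mem' := by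
    rintro c v ⟨X, hX⟩
    have h0 : S.theta p X = 0 := by rw [theta, hX, contactForm_hlift]
    have hJ := S.d_inducedJ p X h0
    refine ⟨c.re • X + c.im • S.inducedJ p X, ?_⟩
    rw [map_add, map_smul, map_smul, hJ, hX, J, ← hlift_smul, ← hlift_smul, ← hlift_add]
    congr 1
    ext β
    simp only [hlift, PiLp.add_apply, PiLp.smul_apply, smul_eq_mul, Complex.real_smul]
    conv_rhs => rw [← Complex.re_add_im c]
    ring

/-- The `(1,0)`-part of the normal bundle: the complement of `holTangent` in the `(1,0)`-bundle
of `H_n`, orthogonal for the Hermitian Levi form, for which the frame `Z_β` is unitary. It is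
identified with the real normal bundle in `ξ` by `V ↦ (V - i J V) / 2`; thus
`∑ v_β Z_β` corresponds to the real vector `hlift v`. -/
def normalSpace (p : M) : Submodule ℂ (CVec n) := (S.holTangent p)ᗮ

/-- The pseudohermitian connection of `H_n`, for which the frame `Z_β` is parallel, on sections
`∑ W_β Z_β` along `M` of the `(1,0)`-bundle, in the direction `X`. -/
def nabla (p : M) (X : TangentSpace (𝓡 (2 * m + 1)) p) (W : M → CVec n) : CVec n :=
  mfderiv (𝓡 (2 * m + 1)) 𝓘(ℝ, CVec n) W p X

/-- The orthogonal projection of the `(1,0)`-bundle onto its normal part. -/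
def normalProj (p : M) (v : CVec n) : S.normalSpace p :=
  (S.normalSpace p).orthogonalProjectionOnto v

/-- The normal connection: the normal part of the pseudohermitian connection of `H_n`
(applied to sections `W` of the normal bundle). -/
def normalConnection (p : M) (X : TangentSpace (𝓡 (2 * m + 1)) p) (W : M → CVec n) :
    S.normalSpace p :=
  S.normalProj p (nabla p X W)

/-- The section of the `(1,0)`-bundle of `M` obtained by projecting the left invariant
field `∑ v_β Z_β` orthogonally to that bundle. It extends `v` if `v ∈ S.holTangent p`. -/
def extend (v : CVec n) : M → CVec n := fun q => (S.holTangent q).starProjection v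

/-- The second fundamental form `II`, evaluated on the `(1,0)`-parts `(X - i J X) / 2` and
`(Y - i J Y) / 2` of vectors `X, Y ∈ ker (ι^*Θ)`: the normal part of the
derivative of a `(1,0)`-section extending the first vector in the direction of the second one.
(It does not depend on the extension.) -/
def secondFundamentalForm (p : M) (X Y : TangentSpace (𝓡 (2 * m + 1)) p) : S.normalSpace p :=
  S.normalProj p ((1 / 2 : ℂ) • (nabla p Y (S.extend (S.d p X).1)
    - Complex.I • nabla p (S.inducedJ p Y) (S.extend (S.d p X).1)))

/-- There is exactly one normal horizontal vector `ν` such that `T + ν` is tangent to `M`. -/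
theorem existsUnique_fundamentalVector (p : M) :
    ∃! v : S.normalSpace p, ∃ X : TangentSpace (𝓡 (2 * m + 1)) p,
      S.d p X = T n + hlift (S p) (v : CVec n) := by
  obtain ⟨X₀, hX₀⟩ := S.transverse p
  change S.theta p X₀ ≠ 0 at hX₀
  obtain ⟨X, hX⟩ : ∃ X, S.theta p X = 1 := by
    refine ⟨(S.theta p X₀)⁻¹ • X₀, ?_⟩
    rw [theta, map_smul, contactForm_smul]
    exact inv_mul_cancel₀ hX₀
  obtain ⟨u, hu, v, hv, huv⟩ := (S.holTangent p).exists_add_mem_mem_orthogonal (S.d p X).1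
  obtain ⟨X', hX'⟩ := hu
  refine ⟨⟨v, hv⟩, ⟨X - X', ?_⟩, ?_⟩
  · rw [map_sub, hX', eq_hlift_add (S p) (S.d p X), huv, hlift_add]
    change _ + S.theta p X • T n - _ = _
    rw [hX]
    module
  · rintro ⟨w, hw⟩ ⟨Y, hY⟩
    have hmem : w - v ∈ S.holTangent p := by
      refine ⟨Y - (X - X'), ?_⟩
      have h1 : S.d p (X - X') = T n + hlift (S p) v := by
        rw [map_sub, hX', eq_hlift_add (S p) (S.d p X), huv, hlift_add]
        change _ + S.theta p X • T n - _ = _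
        rw [hX]
        module
      have h2 : hlift (S p) w = hlift (S p) (w - v) + hlift (S p) v := by
        rw [← hlift_add, sub_add_cancel]
      rw [map_sub, hY, h1, h2]
      module
    have hort : w - v ∈ (S.holTangent p)ᗮ := Submodule.sub_mem _ hw hv
    have h0 : w - v = 0 := by
      have := Submodule.inner_right_of_mem_orthogonal hmem hort
      exact inner_self_eq_zero.1 this
    exact Subtype.ext (sub_eq_zero.1 h0)

/-- The fundamental vector field `ν`: the normal horizontal vector such that `T + ν` is
tangent to `M`. -/
def fundamentalVector (p : M) : S.normalSpace p := (S.existsUnique_fundamentalVector p).choose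

end PseudohermitianSubmanifold

/-- The family `F` of complex linear isometries of normal spaces is a (smooth) isomorphism of the
Hermitian vector bundles of normal `(1,0)`-vectors, covers the diffeomorphism `φ`,
and preserves the induced pseudohermitian structures, the second fundamental forms, the normal
connections and the fundamental vector fields. -/
structure PreservesInvariants {m n : ℕ}
    {M : Type*} [TopologicalSpace M] [ChartedSpace (EuclideanSpace ℝ (Fin (2 * m + 1))) M]
    [IsManifold (𝓡 (2 * m + 1)) ∞ M]
    {N : Type*} [TopologicalSpace N] [ChartedSpace (EuclideanSpace ℝ (Fin (2 * m + 1))) N]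
    [IsManifold (𝓡 (2 * m + 1)) ∞ N]
    (S : PseudohermitianSubmanifold m n M) (S' : PseudohermitianSubmanifold m n N)
    (φ : Diffeomorph (𝓡 (2 * m + 1)) (𝓡 (2 * m + 1)) M N ∞)
    (F : ∀ p, S.normalSpace p ≃ₗᵢ[ℂ] S'.normalSpace (φ p)) : Prop where
  /-- `F` maps smooth local sections to smooth local sections. -/
  smooth : ∀ (U : Set M) (V : ∀ q, S.normalSpace q), IsOpen U →
    ContMDiffOn (𝓡 (2 * m + 1)) 𝓘(ℝ, CVec n) ∞ (fun q => (V q : CVec n)) U →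
    ContMDiffOn (𝓡 (2 * m + 1)) 𝓘(ℝ, CVec n) ∞ (fun q => (F q (V q) : CVec n)) U
  contactForm_eq : ∀ (p : M) (X : TangentSpace (𝓡 (2 * m + 1)) p),
    S'.theta (φ p) (mfderiv (𝓡 (2 * m + 1)) (𝓡 (2 * m + 1)) φ p X) = S.theta p X
  map_J : ∀ (p : M) (X : TangentSpace (𝓡 (2 * m + 1)) p), S.theta p X = 0 →
    mfderiv (𝓡 (2 * m + 1)) (𝓡 (2 * m + 1)) φ p (S.inducedJ p X) =
      S'.inducedJ (φ p) (mfderiv (𝓡 (2 * m + 1)) (𝓡 (2 * m + 1)) φ p X)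
  secondFundamentalForm_eq : ∀ (p : M) (X Y : TangentSpace (𝓡 (2 * m + 1)) p)
    (V : S.normalSpace p), S.theta p X = 0 → S.theta p Y = 0 →
    inner ℂ (F p V) (S'.secondFundamentalForm (φ p)
        (mfderiv (𝓡 (2 * m + 1)) (𝓡 (2 * m + 1)) φ p X)
        (mfderiv (𝓡 (2 * m + 1)) (𝓡 (2 * m + 1)) φ p Y)) =
      inner ℂ V (S.secondFundamentalForm p X Y)
  normalConnection_eq : ∀ (U : Set M) (V : ∀ q, S.normalSpace q), IsOpen U →
    ContMDiffOn (𝓡 (2 * m + 1)) 𝓘(ℝ, CVec n) ∞ (fun q => (V q : CVec n)) U →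
    ∀ p ∈ U, ∀ X : TangentSpace (𝓡 (2 * m + 1)) p,
    F p (S.normalConnection p X (fun q => (V q : CVec n))) =
      S'.normalConnection (φ p) (mfderiv (𝓡 (2 * m + 1)) (𝓡 (2 * m + 1)) φ p X)
        (fun r => (F (φ.symm r) (V (φ.symm r)) : CVec n))
  fundamentalVector_eq : ∀ p : M, F p (S.fundamentalVector p) = S'.fundamentalVector (φ p)

end

noncomputable section

open Heis
open scoped InnerProductSpace Topology

/-! ### The linear algebra of the difference of two adapted connections -/

/-! The left invariant frame `Z_β` is parallel, so covariant differentiation along `M` is ordinary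
differentiation of `ℂⁿ`-valued functions, and the soldering form is `ζ = dz`, the first component of
the differential of the immersion.

Suppose the invariants agree, and pull the second immersion `(z', t')` back to `M`. Equal contact
forms have equal exterior derivatives, which are imaginary parts of Hermitian products;
compatibility with `J` recovers the real parts, so the differential is unitary on (1,0)-vectors.
Together with `F` it gives a unitary `U p` of `ℂⁿ`, and preservation of `ν` says that `U` also
matches the Reeb directions. Hence `dz' = U dz` on all of `TM` (`exists_isometry`).

Since `d(dz') = 0`, the expression `dU(X) ζ(Y)` is symmetric in `X, Y`, and `Ω = U⁻¹ dU` is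
skew-Hermitian. Equality of normal connections kills the normal block of `Ω`; equality of second
fundamental forms kills the (1,0)-part of the block from tangential to normal vectors. By
`skew_form_eq_zero` these conditions force `Ω = 0`. So `U` is constant, `z' = U z + b`, and equality
of contact forms fixes `t'` up to a constant: the result is a rigid motion.

Conversely, the same algebra with all of `ℂⁿ` as tangential space shows that a rigid motion acts on
the frame by a constant unitary matrix. `inner_secondFundamentalForm_comp` and
`normalConnection_comp` measure the change of the invariants by `dU` and serve both directions. -/

theorem eq_zero_of_inner_orthogonal {V : Type*} [NormedAddCommGroup V] [InnerProductSpace ℂ V]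
    (A : Submodule ℂ V) [A.HasOrthogonalProjection] {v : V}
    (h₁ : ∀ u ∈ A, ⟪u, v⟫_ℂ = 0) (h₂ : ∀ w ∈ Aᗮ, ⟪w, v⟫_ℂ = 0) : v = 0 := by
  have h : v ∈ Aᗮ := (Submodule.mem_orthogonal A v).2 h₁
  exact inner_self_eq_zero.1 (h₂ v h)

/-- A skew-Hermitian one-form `Ω` that is symmetric with respect to a soldering form `ζ` and whose
normal part and second fundamental form vanish is zero. -/
theorem skew_form_eq_zero {E V : Type*} [AddCommGroup E] [Module ℝ E]
    [NormedAddCommGroup V] [InnerProductSpace ℂ V]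
    (A : Submodule ℂ V) [A.HasOrthogonalProjection]
    (θ : E →ₗ[ℝ] ℝ) (ζ : E → V) (Ω : E →ₗ[ℝ] (V →L[ℂ] V)) (R : E)
    (hA : ∀ v ∈ A, ∃ X, θ X = 0 ∧ ζ X = v) (hζ : ∀ X, θ X = 0 → ζ X ∈ A)
    (hR : θ R = 1)
    (skew : ∀ X v w, ⟪Ω X v, w⟫_ℂ + ⟪v, Ω X w⟫_ℂ = 0)
    (symm : ∀ X Y, Ω X (ζ Y) = Ω Y (ζ X))
    (normal : ∀ X, ∀ v ∈ Aᗮ, ∀ w ∈ Aᗮ, ⟪w, Ω X v⟫_ℂ = 0)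
    (second : ∀ X Y Y', θ X = 0 → θ Y = 0 → θ Y' = 0 → ζ Y' = Complex.I • ζ Y → ∀ w ∈ Aᗮ,
      ⟪w, Ω Y (ζ X) - Complex.I • Ω Y' (ζ X)⟫_ℂ = 0) (X : E) : Ω X = 0 := by
  -- Symmetry moves `Y` into the argument of a complex linear map, so on `A` the form is complex
  -- linear in its contact direction as well.
  have hI : ∀ Y Y', θ Y = 0 → θ Y' = 0 → ζ Y' = Complex.I • ζ Y → ∀ v ∈ A,
      Ω Y' v = Complex.I • Ω Y v := by
    intro Y Y' _ _ hYY' v hv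
    obtain ⟨X, hX, rfl⟩ := hA v hv
    rw [symm, hYY', map_smul, symm]
  have hker : ∀ Y, θ Y = 0 → ∀ v ∈ A, Ω Y v = 0 := by
    intro Y hY v hv
    obtain ⟨Y', hY', hYY'⟩ := hA _ (A.smul_mem Complex.I (hζ Y hY))
    -- Tangential part: skewness for `Y` and for `Y'` gives the sum and the difference of the same
    -- two terms, so both vanish. Normal part: complex linearity turns `second` into `2 ⟪w, Ω Y v⟫ =
    -- 0`.
    refine eq_zero_of_inner_orthogonal A (fun u hu => ?_) fun w hw => ?_
    · have h1 := skew Y' u v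
      have h2 := skew Y u v
      rw [hI Y Y' hY hY' hYY' v hv, hI Y Y' hY hY' hYY' u hu, inner_smul_left,
        inner_smul_right, Complex.conj_I] at h1
      have h3 : (2 * Complex.I) * ⟪u, Ω Y v⟫_ℂ = 0 := by linear_combination h1 + Complex.I * h2
      simpa using h3
    · obtain ⟨X, hX, rfl⟩ := hA v hv
      have h1 := second X Y Y' hX hY hY' hYY' w hw
      rw [hI Y Y' hY hY' hYY' _ hv, smul_smul, Complex.I_mul_I, neg_one_smul, sub_neg_eq_add,
        inner_add_right] at h1
      linear_combination h1 / 2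
  -- Killing `A` suffices: on `Aᗮ`, skewness removes the tangential component and `normal` the other
  -- one.
  have hext : ∀ Y, (∀ v ∈ A, Ω Y v = 0) → Ω Y = 0 := by
    intro Y hY
    have hn : ∀ w ∈ Aᗮ, Ω Y w = 0 := fun w hw =>
      eq_zero_of_inner_orthogonal A
        (fun u hu => by simpa [hY u hu] using skew Y u w) (fun w' hw' => normal Y w hw w' hw')
    ext v : 1
    obtain ⟨a, ha, b, hb, rfl⟩ := A.exists_add_mem_mem_orthogonal v
    rw [map_add, hY a ha, hn b hb]
    simp
  -- By symmetry `Ω R (ζ X) = Ω X (ζ R)`, and `Ω X = 0` is already known for contact `X`.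
  have hΩR : Ω R = 0 := hext R fun v hv => by
    obtain ⟨X, hX, rfl⟩ := hA v hv
    rw [symm, hext X (hker X hX)]
    rfl
  have hX : θ (X - θ X • R) = 0 := by simp [hR]
  have h := hext _ (hker _ hX)
  rwa [map_sub, map_smul, hΩR, smul_zero, sub_zero] at h

/-! ### Real derivatives of maps into spaces of complex linear maps -/

section Mixed

variable {E V W : Type*} [NormedAddCommGroup E] [NormedSpace ℝ E]
  [NormedAddCommGroup V] [InnerProductSpace ℂ V]
  [NormedAddCommGroup W] [InnerProductSpace ℂ W]

theorem HasFDerivAt.complex_clm_apply {U : E → V →L[ℂ] W} {U' : E →L[ℝ] (V →L[ℂ] W)} {w : E → V}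
    {w' : E →L[ℝ] V} {x : E} (hU : HasFDerivAt U U' x) (hw : HasFDerivAt w w' x) (X : E) :
    fderiv ℝ (fun y => U y (w y)) x X = U' X (w x) + U x (w' X) := by
  have h1 := ((ContinuousLinearMap.restrictScalarsL ℂ V W ℝ ℝ).hasFDerivAt.comp x hU).clm_apply hw
  have h2 := congrArg (fun L => L X) h1.fderiv
  simp only [Function.comp_def] at h2
  rw [add_comm]
  exact h2

theorem ContDiffAt.complex_clm_apply {U : E → V →L[ℂ] W} {w : E → V} {x : E} {k : ℕ∞ω}
    (hU : ContDiffAt ℝ k U x) (hw : ContDiffAt ℝ k w x) :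
    ContDiffAt ℝ k (fun y => U y (w y)) x := by
  have h1 := ((ContinuousLinearMap.restrictScalarsL ℂ V W ℝ ℝ).contDiff.contDiffAt.comp x hU)
  exact h1.clm_apply hw

/-- Expresses an operator by its values on an orthonormal basis, so that smoothness of an
operator-valued map can be tested on vectors. -/
theorem sum_inner_smulRight (b : OrthonormalBasis (Fin (Module.finrank ℂ V)) ℂ V)
    (U : V →L[ℂ] W) : U = ∑ i, (innerSL ℂ (b i)).smulRight (U (b i)) := by
  ext v
  conv_lhs => rw [← b.sum_repr' v]
  simp [map_sum]

theorem contDiff_innerSL_smulRight (v : V) {k : ℕ∞ω} :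
    ContDiff ℝ k (fun w : W => (innerSL ℂ v).smulRight w) := by
  have h : IsBoundedLinearMap ℝ (fun w : W => (innerSL ℂ v).smulRight w) := by
    refine IsLinearMap.with_bound ⟨fun x y => ?_, fun c x => ?_⟩ ‖v‖ fun w => ?_
    · ext; simp
    · ext u; exact smul_comm (⟪v, u⟫_ℂ) c x
    · simp
  exact h.contDiff

end Mixed

section Calculus

variable {E V : Type*} [NormedAddCommGroup E] [NormedSpace ℝ E]
  [NormedAddCommGroup V] [InnerProductSpace ℂ V]

/-- Differentiating `dz' = U dz` once more and antisymmetrizing removes the symmetric second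
derivatives of `z` and `z'`; what remains is `dU ∧ dz = 0`. -/
theorem fderiv_symm_of_fderiv_eq {U : E → V →L[ℂ] V} {z z' : E → V} {x : E}
    (hz : ContDiffAt ℝ ∞ z x) (hz' : ContDiffAt ℝ ∞ z' x) (hU : DifferentiableAt ℝ U x)
    (h : ∀ᶠ y in 𝓝 x, ∀ X, fderiv ℝ z' y X = U y (fderiv ℝ z y X)) (X Y : E) :
    fderiv ℝ U x X (fderiv ℝ z x Y) = fderiv ℝ U x Y (fderiv ℝ z x X) := by
  have hd : DifferentiableAt ℝ (fderiv ℝ z) x :=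
    (hz.fderiv_right (m := 1) (by norm_cast)).differentiableAt (by norm_num)
  have hd' : DifferentiableAt ℝ (fderiv ℝ z') x :=
    (hz'.fderiv_right (m := 1) (by norm_cast)).differentiableAt (by norm_num)
  have key : ∀ X Y, fderiv ℝ (fderiv ℝ z') x X Y =
      fderiv ℝ U x X (fderiv ℝ z x Y) + U x (fderiv ℝ (fderiv ℝ z) x X Y) := by
    intro X Y
    have h1 : (fun y => fderiv ℝ z' y Y) =ᶠ[𝓝 x] fun y => U y (fderiv ℝ z y Y) :=
      h.mono fun y hy => hy Y
    have h2 := congrArg (fun L => L X) (h1.fderiv_eq (𝕜 := ℝ))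
    have h3 : HasFDerivAt (fun y => fderiv ℝ z y Y)
        ((fderiv ℝ (fderiv ℝ z) x).flip Y) x := by
      simpa using hd.hasFDerivAt.clm_apply (hasFDerivAt_const Y x)
    have h4 : HasFDerivAt (fun y => fderiv ℝ z' y Y)
        ((fderiv ℝ (fderiv ℝ z') x).flip Y) x := by
      simpa using hd'.hasFDerivAt.clm_apply (hasFDerivAt_const Y x)
    simp only [hU.hasFDerivAt.complex_clm_apply h3, h4.fderiv] at h2
    exact h2
  have hs := (hz.isSymmSndFDerivAt (by simp; norm_cast)).eq X Y
  have hs' := (hz'.isSymmSndFDerivAt (by simp; norm_cast)).eq X Y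
  rw [key, key, hs] at hs'
  exact add_right_cancel hs'

theorem inner_fderiv_skew {U : E → V →L[ℂ] V} {x : E} (hU : DifferentiableAt ℝ U x)
    (h : ∀ᶠ y in 𝓝 x, ∀ v w, ⟪U y v, U y w⟫_ℂ = ⟪v, w⟫_ℂ) (X : E) (v w : V) :
    ⟪fderiv ℝ U x X v, U x w⟫_ℂ + ⟪U x v, fderiv ℝ U x X w⟫_ℂ = 0 := by
  have hd : ∀ v, HasFDerivAt (fun y => U y v)
      ((ContinuousLinearMap.restrictScalarsL ℂ V V ℝ ℝ ∘L fderiv ℝ U x).flip v) x := fun v => by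
    simpa using ((ContinuousLinearMap.restrictScalarsL ℂ V V ℝ ℝ).hasFDerivAt.comp x
      hU.hasFDerivAt).clm_apply (hasFDerivAt_const v x)
  have h1 := ((hd v).inner ℂ (hd w)).fderiv
  have h2 : (fun y => ⟪U y v, U y w⟫_ℂ) =ᶠ[𝓝 x] fun _ => ⟪v, w⟫_ℂ := h.mono fun y hy => hy v w
  rw [h2.fderiv_eq] at h1
  have h3 := congrArg (fun L => L X) h1
  simp at h3
  rw [add_comm]
  exact h3.symm

end Calculus

/-! ### The contact form and its exterior derivative -/

namespace Heis

variable {n : ℕ}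

/-- The product is conjugate linear in its first argument, so its imaginary part is `∑ (x dy - y
dx)`. -/
theorem contactForm_eq_inner (p X : Heis n) : contactForm p X = X.2 + (⟪p.1, X.1⟫_ℂ).im := by
  simp [contactForm, PiLp.inner_apply, Complex.im_sum, sub_eq_add_neg, mul_comm, add_comm]

@[simp] theorem hlift_fst (p : Heis n) (v : CVec n) : (hlift p v).1 = v := rfl

theorem eq_hlift_of_contactForm_eq_zero {p X : Heis n} (h : contactForm p X = 0) :
    X = hlift p X.1 := by
  conv_lhs => rw [eq_hlift_add p X, h, zero_smul, add_zero]

theorem contactForm_add (p X Y : Heis n) :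
    contactForm p (X + Y) = contactForm p X + contactForm p Y := by
  simp only [contactForm_eq_inner, Prod.snd_add, Prod.fst_add, inner_add_right, Complex.add_im]
  ring

theorem contactForm_T (p : Heis n) : contactForm p (T n) = 1 := by
  simp [contactForm_eq_inner, T]

theorem ext_contactForm {p X Y : Heis n} (h1 : X.1 = Y.1)
    (h : contactForm p X = contactForm p Y) : X = Y := by
  rw [eq_hlift_add p X, eq_hlift_add p Y, h1, h]

section

variable {E : Type*} [NormedAddCommGroup E] [NormedSpace ℝ E]

theorem contDiffAt_contactForm {f g : E → Heis n} {x : E} {k : ℕ∞ω} (hf : ContDiffAt ℝ k f x)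
    (hg : ContDiffAt ℝ k g x) : ContDiffAt ℝ k (fun y => contactForm (f y) (g y)) x := by
  simp only [contactForm_eq_inner]
  exact hg.snd.add (Complex.imCLM.contDiff.contDiffAt.comp x (hf.fst.inner ℂ hg.fst))

theorem fderiv_contactForm {f : E → Heis n} {x : E} (hf : ContDiffAt ℝ ∞ f x) (X Y : E) :
    fderiv ℝ (fun y => contactForm (f y) (fderiv ℝ f y X)) x Y =
      contactForm (f x) (fderiv ℝ (fderiv ℝ f) x Y X) +
        (⟪(fderiv ℝ f x Y).1, (fderiv ℝ f x X).1⟫_ℂ).im := by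
  have hd : DifferentiableAt ℝ (fderiv ℝ f) x :=
    (hf.fderiv_right (m := 1) (by norm_cast)).differentiableAt (by norm_num)
  have h0 : HasFDerivAt f (fderiv ℝ f x) x := (hf.differentiableAt (by norm_num)).hasFDerivAt
  have h1 : HasFDerivAt (fun y => fderiv ℝ f y X) ((fderiv ℝ (fderiv ℝ f) x).flip X) x := by
    simpa using hd.hasFDerivAt.clm_apply (hasFDerivAt_const X x)
  have h2 := h1.snd.add
    (Complex.imCLM.hasFDerivAt.comp x (h0.fst.inner ℂ h1.fst))
  have h3 := congrArg (fun L => L Y) h2.fderiv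
  simp only [contactForm_eq_inner]
  refine Eq.trans h3 ?_
  simp [add_assoc]

/-- Two maps that pull the contact form back to the same form also have the same pulled back Levi
form. -/
theorem im_inner_fderiv_eq {f g : E → Heis n} {x : E} (hf : ContDiffAt ℝ ∞ f x)
    (hg : ContDiffAt ℝ ∞ g x)
    (h : ∀ᶠ y in 𝓝 x, ∀ X, contactForm (g y) (fderiv ℝ g y X) =
      contactForm (f y) (fderiv ℝ f y X)) (X Y : E) :
    (⟪(fderiv ℝ g x X).1, (fderiv ℝ g x Y).1⟫_ℂ).im =
      (⟪(fderiv ℝ f x X).1, (fderiv ℝ f x Y).1⟫_ℂ).im := by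
  have key : ∀ X Y, contactForm (g x) (fderiv ℝ (fderiv ℝ g) x Y X) +
        (⟪(fderiv ℝ g x Y).1, (fderiv ℝ g x X).1⟫_ℂ).im =
      contactForm (f x) (fderiv ℝ (fderiv ℝ f) x Y X) +
        (⟪(fderiv ℝ f x Y).1, (fderiv ℝ f x X).1⟫_ℂ).im := by
    intro X Y
    rw [← fderiv_contactForm hf, ← fderiv_contactForm hg]
    have h1 : (fun y => contactForm (g y) (fderiv ℝ g y X)) =ᶠ[𝓝 x]
      fun y => contactForm (f y) (fderiv ℝ f y X) := h.mono fun y hy => hy X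
    rw [h1.fderiv_eq]
  -- Exchanging `X, Y` in `key` and subtracting cancels the symmetric second derivatives and doubles
  -- the antisymmetric imaginary parts: this is equality of the pullbacks of `dΘ`.
  have hs : ∀ {f : E → Heis n}, ContDiffAt ℝ ∞ f x → fderiv ℝ (fderiv ℝ f) x X Y =
      fderiv ℝ (fderiv ℝ f) x Y X :=
    fun hf => (hf.isSymmSndFDerivAt (by simp; norm_cast)).eq X Y
  have sk : ∀ a b : CVec n, (⟪a, b⟫_ℂ).im = -(⟪b, a⟫_ℂ).im := fun a b => by
    rw [← inner_conj_symm, Complex.conj_im]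
  have h1 := key X Y
  have h2 := key Y X
  rw [hs hf, hs hg] at h2
  rw [sk (fderiv ℝ g x Y).1, sk (fderiv ℝ f x Y).1] at h1
  linarith

end

end Heis

/-! ### Smooth dependence of orthogonal projections -/

section Projection

variable {V : Type*} [NormedAddCommGroup V] [InnerProductSpace ℂ V] [FiniteDimensional ℂ V]

theorem contDiffAt_real_ringInverse (u : (V →L[ℂ] V)ˣ) :
    ContDiffAt ℝ ∞ (Ring.inverse : (V →L[ℂ] V) → (V →L[ℂ] V)) u :=
  have : CompleteSpace V := FiniteDimensional.complete ℂ V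
  (contDiffAt_ringInverse ℂ u).restrict_scalars ℝ

theorem ContDiffAt.complex_clm_mul {E : Type*} [NormedAddCommGroup E] [NormedSpace ℝ E]
    {f g : E → V →L[ℂ] V} {x : E} {k : ℕ∞ω} (hf : ContDiffAt ℝ k f x) (hg : ContDiffAt ℝ k g x) :
    ContDiffAt ℝ k (fun y => f y * g y) x := by
  have h : ContDiff ℝ k (fun p : (V →L[ℂ] V) × (V →L[ℂ] V) => p.1 * p.2) :=
    (contDiff_mul (𝕜 := ℂ)).restrict_scalars ℝ
  exact h.contDiffAt.comp x (hf.prodMk hg)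

/-- The orthogonal projection onto a subspace `B` that is the image of a fixed subspace `A` under
an operator `K` close to the identity is a smooth function of `K`. -/
theorem exists_contDiffAt_starProjection (A : Submodule ℂ V) :
    ∃ Ψ : (V →L[ℂ] V) → (V →L[ℂ] V), ContDiffAt ℝ ∞ Ψ 1 ∧
      ∀ᶠ K in 𝓝 (1 : V →L[ℂ] V), ∀ B : Submodule ℂ V,
        Module.finrank ℂ B = Module.finrank ℂ A → (∀ v ∈ A, K v ∈ B) →
        B.starProjection = Ψ K := by
  have : CompleteSpace V := FiniteDimensional.complete ℂ V
  set P := A.starProjection with hP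
  have hPP : P * P = P := Submodule.isIdempotentElem_starProjection A
  have hsP : ∀ B : Submodule ℂ V, star B.starProjection = B.starProjection := fun B =>
    isSelfAdjoint_starProjection B
  -- `Q = K P K⁻¹` is an oblique projection onto `B = K(A)`. The orthogonal projection `P_B`
  -- satisfies `P_B Q = Q` and `P_B Q* = P_B`, hence `P_B (Q + Q* - 1) = Q`. At `K = 1` the factor
  -- `D` is the reflection `2P - 1`, its own inverse, so it stays invertible nearby.
  let Q : (V →L[ℂ] V) → (V →L[ℂ] V) := fun K => K * P * Ring.inverse K
  let D : (V →L[ℂ] V) → (V →L[ℂ] V) := fun K => Q K + star (Q K) - 1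
  have hQ : ContDiffAt ℝ ∞ Q 1 :=
    (contDiffAt_id.complex_clm_mul contDiffAt_const).complex_clm_mul (contDiffAt_real_ringInverse 1)
  have hQ1 : Q 1 = P := by simp [Q]
  have hstar : ContDiff ℝ ∞ (star : (V →L[ℂ] V) → (V →L[ℂ] V)) :=
    (starL' ℝ : (V →L[ℂ] V) ≃L[ℝ] (V →L[ℂ] V)).contDiff
  have hD : ContDiffAt ℝ ∞ D 1 :=
    (hQ.add (hstar.contDiffAt.comp 1 hQ)).sub contDiffAt_const
  have hD1 : D 1 * D 1 = 1 := by
    simp only [D, hQ1, hsP, hP]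
    rw [← hP]
    have : (P + P - 1) * (P + P - 1) = (4 : ℂ) • (P * P - P) + 1 := by
      simp only [mul_sub, sub_mul, mul_add, add_mul, one_mul, mul_one]
      module
    rw [this, hPP, sub_self, smul_zero, zero_add]
  let u : (V →L[ℂ] V)ˣ := ⟨D 1, D 1, hD1, hD1⟩
  refine ⟨fun K => Q K * Ring.inverse (D K), hQ.complex_clm_mul ?_, ?_⟩
  · exact ContDiffAt.comp (g := Ring.inverse) (1 : V →L[ℂ] V) (contDiffAt_real_ringInverse u) hD
  · have h1 : ∀ᶠ K in 𝓝 (1 : V →L[ℂ] V), IsUnit K :=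
      Units.isOpen.mem_nhds isUnit_one
    have h2 : ∀ᶠ K in 𝓝 (1 : V →L[ℂ] V), IsUnit (D K) :=
      hD.continuousAt.eventually_mem (Units.isOpen.mem_nhds ⟨u, rfl⟩)
    filter_upwards [h1, h2] with K hK hDK B hB hAB
    have hinj : Function.Injective K := by
      intro v w hvw
      have h : ∀ v, Ring.inverse K (K v) = v := fun v =>
        congrArg (fun L : V →L[ℂ] V => L v) (Ring.inverse_mul_cancel K hK)
      exact (h v).symm.trans ((congrArg (Ring.inverse K : V →L[ℂ] V) hvw).trans (h w))
    have hmap : A.map (K : V →ₗ[ℂ] V) = B := by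
      refine Submodule.eq_of_le_of_finrank_eq (Submodule.map_le_iff_le_comap.2 hAB) ?_
      exact (LinearEquiv.finrank_eq (Submodule.equivMapOfInjective _ hinj A)).symm.trans hB.symm
    have hBQ : B.starProjection * Q K = Q K := by
      ext v : 1
      exact Submodule.starProjection_eq_self_iff.2 (hAB _ (Submodule.starProjection_apply_mem _ _))
    have hQB : Q K * B.starProjection = B.starProjection := by
      ext v : 1
      obtain ⟨a, ha, hav⟩ : ∃ a ∈ A, K a = B.starProjection v :=
        hmap.ge (Submodule.starProjection_apply_mem B v)
      have h : Ring.inverse K (K a) = a :=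
        congrArg (fun L : V →L[ℂ] V => L a) (Ring.inverse_mul_cancel K hK)
      change K (P (Ring.inverse K (B.starProjection v))) = B.starProjection v
      rw [← hav, h]
      exact congrArg K (Submodule.starProjection_eq_self_iff.2 ha)
    have hBs : B.starProjection * star (Q K) = B.starProjection := by
      have := congrArg star hQB
      rwa [star_mul, hsP] at this
    have h3 : B.starProjection * D K = Q K := by
      simp only [D]
      rw [mul_sub, mul_add, hBQ, hBs, mul_one, add_sub_cancel_right]
    rw [← h3, mul_assoc, Ring.mul_inverse_cancel _ hDK, mul_one]

end Projection

/-! ### Maps from a manifold to a vector space, in a chart -/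

section Chart

variable {d : ℕ} {M : Type*} [TopologicalSpace M] [ChartedSpace (EuclideanSpace ℝ (Fin d)) M]
  {W : Type*} [NormedAddCommGroup W] [NormedSpace ℝ W]

/-- The derivative of a map from a manifold to a vector space. -/
def vderiv (g : M → W) (p : M) : TangentSpace (𝓡 d) p →L[ℝ] W := mfderiv (𝓡 d) 𝓘(ℝ, W) g p

theorem vderiv_eq_fderiv_chart {g : M → W} {p : M} (hg : MDifferentiableAt (𝓡 d) 𝓘(ℝ, W) g p)
    (X : TangentSpace (𝓡 d) p) : vderiv g p X =
      fderiv ℝ (g ∘ (extChartAt (𝓡 d) p).symm) (extChartAt (𝓡 d) p p) X := by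
  have h : mfderiv (𝓡 d) 𝓘(ℝ, W) g p =
      fderivWithin ℝ (g ∘ (extChartAt (𝓡 d) p).symm) (Set.range (𝓡 d)) (extChartAt (𝓡 d) p p) :=
    if_pos hg
  rw [vderiv, h]
  simp only [modelWithCornersSelf_coe, Set.range_id, fderivWithin_univ]
  rfl

theorem vderiv_comp {d' : ℕ} {N : Type*} [TopologicalSpace N]
    [ChartedSpace (EuclideanSpace ℝ (Fin d')) N] {g : N → W} {f : M → N} {p : M}
    (hg : MDifferentiableAt (𝓡 d') 𝓘(ℝ, W) g (f p))
    (hf : MDifferentiableAt (𝓡 d) (𝓡 d') f p) (X : TangentSpace (𝓡 d) p) :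
    vderiv (g ∘ f) p X = vderiv g (f p) (mfderiv (𝓡 d) (𝓡 d') f p X) := by
  unfold vderiv
  rw [mfderiv_comp p hg hf]
  rfl

theorem vderiv_comp_left {W' : Type*} [NormedAddCommGroup W'] [NormedSpace ℝ W'] {g : W → W'}
    {f : M → W} {p : M} (hg : DifferentiableAt ℝ g (f p))
    (hf : MDifferentiableAt (𝓡 d) 𝓘(ℝ, W) f p) (X : TangentSpace (𝓡 d) p) :
    vderiv (g ∘ f) p X = fderiv ℝ g (f p) (vderiv f p X) := by
  unfold vderiv
  rw [mfderiv_comp p hg.mdifferentiableAt hf, mfderiv_eq_fderiv]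
  rfl

theorem contMDiffAt_iff_chart {g : M → W} {p : M} :
    ContMDiffAt (𝓡 d) 𝓘(ℝ, W) ∞ g p ↔
      ContDiffAt ℝ ∞ (g ∘ (extChartAt (𝓡 d) p).symm) (extChartAt (𝓡 d) p p) := by
  rw [contMDiffAt_iff_source]
  simp only [modelWithCornersSelf_coe, Set.range_id, contMDiffWithinAt_univ]
  exact contMDiffAt_iff_contDiffAt

variable [IsManifold (𝓡 d) ∞ M]

theorem fderiv_chart {g : M → W} (hg : MDifferentiable (𝓡 d) 𝓘(ℝ, W) g) {p : M}
    {x : EuclideanSpace ℝ (Fin d)} (hx : x ∈ (extChartAt (𝓡 d) p).target)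
    (X : EuclideanSpace ℝ (Fin d)) :
    fderiv ℝ (g ∘ (extChartAt (𝓡 d) p).symm) x X =
      vderiv g ((extChartAt (𝓡 d) p).symm x)
        (mfderiv 𝓘(ℝ, EuclideanSpace ℝ (Fin d)) (𝓡 d) (extChartAt (𝓡 d) p).symm x X) := by
  have h1 : MDifferentiableAt 𝓘(ℝ, EuclideanSpace ℝ (Fin d)) (𝓡 d) (extChartAt (𝓡 d) p).symm x :=
    ((contMDiffOn_extChartAt_symm (n := ∞) p).contMDiffAt
      ((isOpen_extChartAt_target p).mem_nhds hx)).mdifferentiableAt (by norm_num)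
  rw [← mfderiv_eq_fderiv, mfderiv_comp x (hg _) h1]
  rfl

theorem eq_of_mfderiv_eq_zero [PreconnectedSpace M] {g : M → W}
    (hg : ContMDiff (𝓡 d) 𝓘(ℝ, W) ∞ g) (h : ∀ p, vderiv (d := d) g p = 0) (p q : M) :
    g p = g q := by
  refine IsLocallyConstant.apply_eq_of_preconnectedSpace
    ((IsLocallyConstant.iff_eventually_eq g).2 fun p => ?_) p q
  have hd := hg.mdifferentiable (by norm_num)
  have h1 := (isOpen_extChartAt_target (I := 𝓡 d) p).isOpen_inter_preimage_of_fderiv_eq_zero (𝕜 := ℝ)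
    (f := g ∘ (extChartAt (𝓡 d) p).symm) ?_ ?_ {g p}
  · have h2 : extChartAt (𝓡 d) p p ∈ (extChartAt (𝓡 d) p).target ∩
        (g ∘ (extChartAt (𝓡 d) p).symm) ⁻¹' {g p} :=
      ⟨mem_extChartAt_target p, by simp⟩
    filter_upwards [(continuousAt_extChartAt (I := 𝓡 d) p).eventually_mem (h1.mem_nhds h2),
      extChartAt_source_mem_nhds (I := 𝓡 d) p] with q hq hq'
    have := hq.2
    rwa [Set.mem_preimage, Function.comp_apply, (extChartAt (𝓡 d) p).left_inv hq'] at this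
  · intro x hx
    have := contMDiffOn_extChartAt_symm (I := 𝓡 d) (n := ∞) p x hx
    have h2 := (hg.contMDiffAt.comp_contMDiffWithinAt x this).contMDiffAt
      ((isOpen_extChartAt_target p).mem_nhds hx)
    exact (h2.contDiffAt.differentiableAt (by norm_num)).differentiableWithinAt
  · intro x hx
    ext X
    rw [fderiv_chart hd hx, h]
    rfl

omit [IsManifold (𝓡 d) ∞ M] in
theorem vderiv_complex_clm_apply {V W : Type*} [NormedAddCommGroup V] [InnerProductSpace ℂ V]
    [NormedAddCommGroup W] [InnerProductSpace ℂ W]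
    {U : M → V →L[ℂ] W} {w : M → V} {p : M}
    (hU : ContMDiffAt (𝓡 d) 𝓘(ℝ, V →L[ℂ] W) ∞ U p) (hw : ContMDiffAt (𝓡 d) 𝓘(ℝ, V) ∞ w p)
    (X : TangentSpace (𝓡 d) p) :
    vderiv (fun q => U q (w q)) p X = vderiv U p X (w p) + U p (vderiv w p X) := by
  have hU' := contMDiffAt_iff_chart.1 hU
  have hw' := contMDiffAt_iff_chart.1 hw
  have h := hU'.complex_clm_apply hw'
  have h' : ContMDiffAt (𝓡 d) 𝓘(ℝ, W) ∞ (fun q => U q (w q)) p := contMDiffAt_iff_chart.2 h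
  rw [vderiv_eq_fderiv_chart (h'.mdifferentiableAt (by norm_num)),
    vderiv_eq_fderiv_chart (hU.mdifferentiableAt (by norm_num)),
    vderiv_eq_fderiv_chart (hw.mdifferentiableAt (by norm_num))]
  have := (hU'.differentiableAt (by norm_num)).hasFDerivAt.complex_clm_apply
    (hw'.differentiableAt (by norm_num)).hasFDerivAt X
  simp only [Function.comp_apply, extChartAt_to_inv] at this
  exact this

omit [IsManifold (𝓡 d) ∞ M] in
theorem ContMDiffAt.complex_clm_apply {V W : Type*} [NormedAddCommGroup V]
    [InnerProductSpace ℂ V] [NormedAddCommGroup W] [InnerProductSpace ℂ W]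
    {U : M → V →L[ℂ] W} {w : M → V} {p : M}
    (hU : ContMDiffAt (𝓡 d) 𝓘(ℝ, V →L[ℂ] W) ∞ U p) (hw : ContMDiffAt (𝓡 d) 𝓘(ℝ, V) ∞ w p) :
    ContMDiffAt (𝓡 d) 𝓘(ℝ, W) ∞ (fun q => U q (w q)) p :=
  contMDiffAt_iff_chart.2 ((contMDiffAt_iff_chart.1 hU).complex_clm_apply
    (contMDiffAt_iff_chart.1 hw))

omit [IsManifold (𝓡 d) ∞ M] in
theorem contMDiffAt_complex_clm_iff {V W : Type*} [NormedAddCommGroup V]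
    [InnerProductSpace ℂ V] [FiniteDimensional ℂ V] [NormedAddCommGroup W] [InnerProductSpace ℂ W]
    {U : M → V →L[ℂ] W} {p : M} :
    ContMDiffAt (𝓡 d) 𝓘(ℝ, V →L[ℂ] W) ∞ U p ↔
      ∀ v, ContMDiffAt (𝓡 d) 𝓘(ℝ, W) ∞ (fun q => U q v) p := by
  refine ⟨fun h v => h.complex_clm_apply contMDiffAt_const, fun h => ?_⟩
  let b := stdOrthonormalBasis ℂ V
  have h1 : U = fun q => ∑ i, (innerSL ℂ (b i)).smulRight (U q (b i)) :=
    funext fun q => sum_inner_smulRight b (U q)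
  rw [h1]
  refine contMDiffAt_finsetSum fun i _ => ?_
  exact (contDiff_innerSL_smulRight (b i)).contDiffAt.comp_contMDiffAt (h (b i))

end Chart

/-! ### Contact frames and smoothness of the tangential projection -/

namespace PseudohermitianSubmanifold

variable {m n : ℕ} {M : Type*} [TopologicalSpace M]
  [ChartedSpace (EuclideanSpace ℝ (Fin (2 * m + 1))) M] [IsManifold (𝓡 (2 * m + 1)) ∞ M]
  (S : PseudohermitianSubmanifold m n M)

theorem d_injective (p : M) : Function.Injective (S.d p) := S.immersion p

theorem d_eq_vderiv (p : M) : S.d p = vderiv S p := rfl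

theorem contMDiff_fst : ContMDiff (𝓡 (2 * m + 1)) 𝓘(ℝ, CVec n) ∞ (fun p => (S p).1) :=
  (contDiff_fst (𝕜 := ℝ) (E := CVec n) (F := ℝ)).contMDiff.comp S.smooth

theorem vderiv_fst (p : M) (X : TangentSpace (𝓡 (2 * m + 1)) p) :
    vderiv (fun p => (S p).1) p X = (S.d p X).1 := by
  have := vderiv_comp_left (g := (Prod.fst : Heis n → CVec n)) (f := S) (p := p)
    differentiableAt_fst (S.smooth.mdifferentiable (by norm_num) p) X
  rw [fderiv_fst] at this
  exact this

theorem theta_add (p : M) (X Y : TangentSpace (𝓡 (2 * m + 1)) p) :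
    S.theta p (X + Y) = S.theta p X + S.theta p Y := by
  simp only [theta, map_add, contactForm_add]

theorem theta_smul (p : M) (c : ℝ) (X : TangentSpace (𝓡 (2 * m + 1)) p) :
    S.theta p (c • X) = c * S.theta p X := by
  simp only [theta, map_smul, contactForm_smul]

/-- The induced contact form as a linear form. -/
def thetaLM (p : M) : TangentSpace (𝓡 (2 * m + 1)) p →ₗ[ℝ] ℝ where
  toFun := S.theta p
  map_add' := S.theta_add p
  map_smul' := S.theta_smul p

theorem d_eq_hlift {p : M} {X : TangentSpace (𝓡 (2 * m + 1)) p} (hX : S.theta p X = 0) :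
    S.d p X = hlift (S p) (S.d p X).1 := eq_hlift_of_contactForm_eq_zero hX

theorem fst_mem_holTangent {p : M} {X : TangentSpace (𝓡 (2 * m + 1)) p} (hX : S.theta p X = 0) :
    (S.d p X).1 ∈ S.holTangent p := ⟨X, S.d_eq_hlift hX⟩

theorem exists_of_mem_holTangent {p : M} {v : CVec n} (hv : v ∈ S.holTangent p) :
    ∃ X, S.theta p X = 0 ∧ (S.d p X).1 = v := by
  obtain ⟨X, hX⟩ := hv
  exact ⟨X, by rw [theta, hX, contactForm_hlift], by rw [hX, hlift_fst]⟩

theorem ext_of_theta {p : M} {X Y : TangentSpace (𝓡 (2 * m + 1)) p}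
    (h1 : (S.d p X).1 = (S.d p Y).1) (h : S.theta p X = S.theta p Y) : X = Y :=
  S.d_injective p (ext_contactForm h1 h)

theorem fst_inducedJ {p : M} {X : TangentSpace (𝓡 (2 * m + 1)) p} (hX : S.theta p X = 0) :
    (S.d p (S.inducedJ p X)).1 = Complex.I • (S.d p X).1 := by
  rw [S.d_inducedJ p X hX]
  rfl

theorem theta_inducedJ {p : M} {X : TangentSpace (𝓡 (2 * m + 1)) p} (hX : S.theta p X = 0) :
    S.theta p (S.inducedJ p X) = 0 := by
  rw [theta, S.d_inducedJ p X hX, Heis.J, contactForm_hlift]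

theorem exists_d_eq_T_add (p : M) :
    ∃ R, S.d p R = T n + hlift (S p) (S.fundamentalVector p : CVec n) :=
  (S.existsUnique_fundamentalVector p).choose_spec.1

theorem eq_fundamentalVector {p : M} (v : S.normalSpace p)
    {R : TangentSpace (𝓡 (2 * m + 1)) p} (h : S.d p R = T n + hlift (S p) (v : CVec n)) :
    v = S.fundamentalVector p :=
  (S.existsUnique_fundamentalVector p).choose_spec.2 v ⟨R, h⟩

theorem exists_reeb (p : M) :
    ∃ R, S.theta p R = 1 ∧ (S.d p R).1 = (S.fundamentalVector p : CVec n) := by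
  obtain ⟨R, hR⟩ := S.exists_d_eq_T_add p
  refine ⟨R, ?_, ?_⟩
  · rw [theta, hR, contactForm_add, contactForm_T, contactForm_hlift, add_zero]
  · rw [hR]
    simp [T]

theorem d_eq_T_add {p : M} {R : TangentSpace (𝓡 (2 * m + 1)) p} (hR : S.theta p R = 1) :
    S.d p R = T n + hlift (S p) (S.d p R).1 := by
  conv_lhs => rw [eq_hlift_add (S p) (S.d p R)]
  rw [show contactForm (S p) (S.d p R) = 1 from hR, one_smul, add_comm]

/-- The form `θ` is onto `ℝ`, so its kernel has real dimension `2m`, and `dz` identifies this kernel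
with the (1,0)-space. Constancy of the rank is needed for `exists_contDiffAt_starProjection`. -/
theorem finrank_holTangent (p : M) : Module.finrank ℂ (S.holTangent p) = m := by
  let e : LinearMap.ker (S.thetaLM p) →ₗ[ℝ] (S.holTangent p) :=
    { toFun := fun X => ⟨(S.d p X.1).1, S.fst_mem_holTangent X.2⟩
      map_add' := fun X Y => Subtype.ext (by simp)
      map_smul' := fun c X => Subtype.ext (by simp) }
  have he : Function.Bijective e := by
    constructor
    · intro X Y h
      refine Subtype.ext (S.ext_of_theta (congrArg Subtype.val h) ?_)
      exact (show S.theta p X.1 = 0 from X.2).trans (show S.theta p Y.1 = 0 from Y.2).symm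
    · rintro ⟨v, hv⟩
      obtain ⟨X, hX, rfl⟩ := S.exists_of_mem_holTangent hv
      exact ⟨⟨X, hX⟩, rfl⟩
  have h1 := (LinearEquiv.ofBijective e he).finrank_eq
  have : FiniteDimensional ℝ (TangentSpace (𝓡 (2 * m + 1)) p) :=
    inferInstanceAs (FiniteDimensional ℝ (EuclideanSpace ℝ (Fin (2 * m + 1))))
  have h2 := LinearMap.finrank_range_add_finrank_ker (S.thetaLM p)
  have h3 : LinearMap.range (S.thetaLM p) = ⊤ := by
    obtain ⟨R, hR, -⟩ := S.exists_reeb p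
    refine LinearMap.range_eq_top.2 fun c => ⟨c • R, ?_⟩
    rw [map_smul, show S.thetaLM p R = 1 from hR, smul_eq_mul, mul_one]
  have h4 : Module.finrank ℝ (TangentSpace (𝓡 (2 * m + 1)) p) = 2 * m + 1 :=
    finrank_euclideanSpace_fin (𝕜 := ℝ)
  rw [h3, finrank_top, h4, h1, finrank_real_of_complex, Module.finrank_self] at h2
  omega

/-- A contact tangent vector extends locally to a smooth contact vector field. -/
theorem exists_contact_extension (p : M) (X : TangentSpace (𝓡 (2 * m + 1)) p)
    (hX : S.theta p X = 0) :
    ∃ s : ∀ q : M, TangentSpace (𝓡 (2 * m + 1)) q, s p = X ∧ (∀ᶠ q in 𝓝 p, S.theta q (s q) = 0) ∧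
      ∀ g : M → Heis n, ContMDiff (𝓡 (2 * m + 1)) 𝓘(ℝ, Heis n) ∞ g →
        ContMDiffAt (𝓡 (2 * m + 1)) 𝓘(ℝ, Heis n) ∞ (fun q => vderiv g q (s q)) p := by
  let E := EuclideanSpace ℝ (Fin (2 * m + 1))
  obtain ⟨R, hR, -⟩ := S.exists_reeb p
  set c := extChartAt (𝓡 (2 * m + 1)) p with hc
  let a : E → E → ℝ := fun Y x => contactForm (S (c.symm x)) (fderiv ℝ (S ∘ c.symm) x Y)
  -- The field that is constant in the chart, corrected along `R`, which stays transverse near `p`.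
  -- The correction vanishes at `p` because `θ X = 0`.
  let Y : E → E := fun x => (X : E) - (a X x / a R x) • (R : E)
  let s : ∀ q : M, TangentSpace (𝓡 (2 * m + 1)) q := fun q =>
    (mfderiv 𝓘(ℝ, E) (𝓡 (2 * m + 1)) c.symm (c q) (Y (c q)) : E)
  have hs : ∀ g : M → Heis n, ContMDiff (𝓡 (2 * m + 1)) 𝓘(ℝ, Heis n) ∞ g → ∀ q ∈ c.source,
      vderiv g q (s q) = fderiv ℝ (g ∘ c.symm) (c q) (Y (c q)) := by
    intro g hg q hq
    have h1 := fderiv_chart (hg.mdifferentiable (by norm_num)) (c.map_source hq) (Y (c q))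
    refine Eq.trans ?_ h1.symm
    exact congrArg (fun q' : M => (vderiv g q' : E →L[ℝ] Heis n)
      (mfderiv 𝓘(ℝ, E) (𝓡 (2 * m + 1)) c.symm (c q) (Y (c q)) : E)) (c.left_inv hq).symm
  have hsm : ∀ g : M → Heis n, ContMDiff (𝓡 (2 * m + 1)) 𝓘(ℝ, Heis n) ∞ g →
      ContDiffAt ℝ ∞ (fun x => fderiv ℝ (g ∘ c.symm) x) (c p) := fun g hg =>
    (contMDiffAt_iff_chart.1 hg.contMDiffAt).fderiv_right (by norm_cast)
  have ha : ∀ Z, ContDiffAt ℝ ∞ (a Z) (c p) := fun Z =>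
    contDiffAt_contactForm (contMDiffAt_iff_chart.1 S.smooth.contMDiffAt)
      ((hsm S S.smooth).clm_apply contDiffAt_const)
  have hap : ∀ Z : E, a Z (c p) = S.theta p Z := fun Z =>
    congrArg₂ contactForm (congrArg S (extChartAt_to_inv (I := 𝓡 (2 * m + 1)) p))
      (vderiv_eq_fderiv_chart (S.smooth.mdifferentiable (by norm_num) p) Z).symm
  have hR0 : a R (c p) ≠ 0 := ((hap R).trans hR).trans_ne one_ne_zero
  have hY : ContDiffAt ℝ ∞ Y (c p) :=
    contDiffAt_const.sub (((ha X).div (ha R) hR0).smul contDiffAt_const)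
  refine ⟨s, ?_, ?_, fun g hg => ?_⟩
  · apply S.d_injective p
    rw [d_eq_vderiv, hs S S.smooth p (mem_extChartAt_source p),
      vderiv_eq_fderiv_chart (S.smooth.mdifferentiable (by norm_num) p)]
    have : Y (c p) = X := by
      have h0 : a X (c p) = 0 := (hap X).trans hX
      simp only [Y, h0, zero_div]
      exact (congrArg (@HSub.hSub E E E _ X) (zero_smul ℝ (R : E))).trans (sub_zero (X : E))
    rw [this]
  · have h1 : ∀ᶠ x in 𝓝 (c p), a R x ≠ 0 := (ha R).continuousAt.eventually_ne hR0
    filter_upwards [(continuousAt_extChartAt (I := 𝓡 (2 * m + 1)) p).eventually h1,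
      extChartAt_source_mem_nhds (I := 𝓡 (2 * m + 1)) p] with q hq hq'
    rw [theta, d_eq_vderiv, hs S S.smooth q hq']
    have h2 : a X (c q) - (a X (c q) / a R (c q)) * a R (c q) = 0 := by
      rw [div_mul_cancel₀ _ hq, sub_self]
    simp only [a, c.left_inv hq'] at h2
    have h3 : fderiv ℝ (S ∘ c.symm) (c q) (Y (c q)) = fderiv ℝ (S ∘ c.symm) (c q) X -
        (a X (c q) / a R (c q)) • fderiv ℝ (S ∘ c.symm) (c q) R :=
      (map_sub _ _ _).trans (congrArg _ (map_smul _ _ _))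
    rw [h3, contactForm_sub, contactForm_smul]
    simp only [a, c.left_inv hq']
    exact h2
  · have h1 : ContMDiffAt (𝓡 (2 * m + 1)) 𝓘(ℝ, Heis n) ∞
        (fun q => fderiv ℝ (g ∘ c.symm) (c q) (Y (c q))) p :=
      ((hsm g hg).clm_apply hY).comp_contMDiffAt contMDiffAt_extChartAt
    refine h1.congr_of_eventuallyEq ?_
    filter_upwards [extChartAt_source_mem_nhds (I := 𝓡 (2 * m + 1)) p] with q hq
    exact hs g hg q hq

/-- Smoothness of the fields is expressed by differentiating arbitrary smooth maps along them, so
that one frame serves two immersions of the same manifold. -/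
theorem exists_contact_frame (p : M) :
    ∃ (b : Fin (Module.finrank ℂ (S.holTangent p)) → CVec n)
      (s : Fin (Module.finrank ℂ (S.holTangent p)) → ∀ q : M, TangentSpace (𝓡 (2 * m + 1)) q),
      (∑ i, (innerSL ℂ (b i)).smulRight (S.d p (s i p)).1 = (S.holTangent p).starProjection) ∧
      (∀ᶠ q in 𝓝 p, ∀ i, S.theta q (s i q) = 0) ∧
      ∀ g : M → Heis n, ContMDiff (𝓡 (2 * m + 1)) 𝓘(ℝ, Heis n) ∞ g → ∀ i,
        ContMDiffAt (𝓡 (2 * m + 1)) 𝓘(ℝ, Heis n) ∞ (fun q => vderiv g q (s i q)) p := by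
  let b := stdOrthonormalBasis ℂ (S.holTangent p)
  choose X hX hXb using fun i => S.exists_of_mem_holTangent (b i).2
  choose s hsp hs0 hs using fun i => S.exists_contact_extension p (X i) (hX i)
  refine ⟨fun i => (b i : CVec n), s, ?_, Filter.eventually_all.2 hs0, fun g hg i => hs i g hg⟩
  ext v : 1
  simp only [hsp, hXb, _root_.sum_apply, ContinuousLinearMap.smulRight_apply]
  have h := congrArg Subtype.val (b.sum_repr' ((S.holTangent p).orthogonalProjectionOnto v))
  rw [Submodule.starProjection_apply, ← h]
  simp only [Submodule.coe_sum, Submodule.coe_smul]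
  refine Finset.sum_congr rfl fun i _ => ?_
  rw [Submodule.inner_orthogonalProjectionOnto_eq_of_mem_left]
  rfl

theorem contMDiff_starProjection :
    ContMDiff (𝓡 (2 * m + 1)) 𝓘(ℝ, CVec n →L[ℂ] CVec n) ∞
      (fun q => (S.holTangent q).starProjection) := by
  intro p
  obtain ⟨Ψ, hΨ, hΨ'⟩ := exists_contDiffAt_starProjection (S.holTangent p)
  obtain ⟨b, s, hs, hs0, hsm⟩ := S.exists_contact_frame p
  -- `K q` sends `b i` to the frame vector at `q` and fixes the orthogonal complement of the
  -- (1,0)-space at `p`. Thus `K p = 1`, and near `p` it maps the (1,0)-space at `p` into the one at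
  -- `q`.
  let K : M → CVec n →L[ℂ] CVec n := fun q =>
    ∑ i, (innerSL ℂ (b i)).smulRight (S.d q (s i q)).1 + (1 - (S.holTangent p).starProjection)
  have hK : ContMDiffAt (𝓡 (2 * m + 1)) 𝓘(ℝ, CVec n →L[ℂ] CVec n) ∞ K p := by
    refine ContMDiffAt.add (contMDiffAt_finsetSum fun i _ => ?_) contMDiffAt_const
    exact ((contDiff_innerSL_smulRight (b i)).comp contDiff_fst).contDiffAt.comp_contMDiffAt
      (hsm S S.smooth i)
  have hKp : K p = 1 := by simp only [K, hs]; abel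
  rw [← hKp] at hΨ hΨ'
  refine (hΨ.comp_contMDiffAt hK).congr_of_eventuallyEq ?_
  filter_upwards [hK.continuousAt.eventually hΨ', hs0] with q hq hq0
  refine hq _ (by rw [finrank_holTangent, finrank_holTangent]) fun v hv => ?_
  have h1 : K q v = ∑ i, ⟪b i, v⟫_ℂ • (S.d q (s i q)).1 := by
    simp [K, Submodule.starProjection_eq_self_iff.2 hv]
  rw [h1]
  exact Submodule.sum_mem _ fun i _ => Submodule.smul_mem _ _ (S.fst_mem_holTangent (hq0 i))

end PseudohermitianSubmanifold

/-! ### The unitary map between the (1,0)-bundles and its derivative -/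

theorem complex_inner_eq_of_im {V : Type*} [NormedAddCommGroup V] [InnerProductSpace ℂ V]
    {a b a' b' : V} (h : (⟪a, b⟫_ℂ).im = (⟪a', b'⟫_ℂ).im)
    (h' : (⟪a, Complex.I • b⟫_ℂ).im = (⟪a', Complex.I • b'⟫_ℂ).im) : ⟪a, b⟫_ℂ = ⟪a', b'⟫_ℂ := by
  rw [inner_smul_right, inner_smul_right, Complex.I_mul_im, Complex.I_mul_im] at h'
  exact Complex.ext h' h

/-- A variant of `skew_form_eq_zero` for the derivative `D` of a family of isometries at a point
where its value is `U`. -/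
theorem isometry_derivative_eq_zero {E V : Type*} [AddCommGroup E] [Module ℝ E]
    [NormedAddCommGroup V] [InnerProductSpace ℂ V] [FiniteDimensional ℂ V]
    (A : Submodule ℂ V) (θ : E →ₗ[ℝ] ℝ) (ζ : E → V) (U : V →L[ℂ] V) (D : E →ₗ[ℝ] (V →L[ℂ] V))
    (R : E) (hi : ∀ v w, ⟪U v, U w⟫_ℂ = ⟪v, w⟫_ℂ)
    (hA : ∀ v ∈ A, ∃ X, θ X = 0 ∧ ζ X = v) (hζ : ∀ X, θ X = 0 → ζ X ∈ A)
    (hR : θ R = 1)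
    (skew : ∀ X v w, ⟪D X v, U w⟫_ℂ + ⟪U v, D X w⟫_ℂ = 0)
    (symm : ∀ X Y, D X (ζ Y) = D Y (ζ X))
    (normal : ∀ X, ∀ v ∈ Aᗮ, ∀ w ∈ Aᗮ, ⟪U w, D X v⟫_ℂ = 0)
    (second : ∀ X Y Y', θ X = 0 → θ Y = 0 → θ Y' = 0 → ζ Y' = Complex.I • ζ Y → ∀ w ∈ Aᗮ,
      ⟪U w, D Y (ζ X) - Complex.I • D Y' (ζ X)⟫_ℂ = 0) (X : E) : D X = 0 := by
  have : CompleteSpace V := FiniteDimensional.complete ℂ V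
  -- Composition with `U* = U⁻¹` turns `D` into a skew-Hermitian form, and since `U*` is injective,
  -- `D` vanishes with it.
  let adj := ContinuousLinearMap.adjoint U
  have hadj : ∀ v w, ⟪v, adj w⟫_ℂ = ⟪U v, w⟫_ℂ := fun v w =>
    ContinuousLinearMap.adjoint_inner_right _ _ _
  have hinj : Function.Injective adj := by
    have h1 : Function.Injective U.toLinearMap := by
      refine (injective_iff_map_eq_zero _).2 fun v hv => ?_
      have := hi v v
      rw [show U v = 0 from hv, inner_zero_left] at this
      exact inner_self_eq_zero.1 this.symm
    have h2 := LinearMap.surjective_of_injective h1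
    refine (injective_iff_map_eq_zero _).2 fun v hv => ?_
    obtain ⟨w, rfl⟩ := h2 v
    have := hadj w (U w)
    rw [show adj (U w) = 0 from hv, inner_zero_right] at this
    exact inner_self_eq_zero.1 this.symm
  let Ω : E →ₗ[ℝ] (V →L[ℂ] V) :=
    { toFun := fun X => adj.comp (D X)
      map_add' := fun X Y => by rw [map_add, ContinuousLinearMap.comp_add]
      map_smul' := fun c X => by
        ext v : 1
        simp only [map_smul, ContinuousLinearMap.comp_apply, _root_.smul_apply,
          RingHom.id_apply]
        exact adj.map_smul_of_tower _ _ }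
  have hΩ : ∀ X v, Ω X v = adj (D X v) := fun _ _ => rfl
  have key := skew_form_eq_zero A θ ζ Ω R hA hζ hR
    (fun X v w => by
      rw [hΩ, hΩ, hadj, ContinuousLinearMap.adjoint_inner_left]
      exact skew X v w)
    (fun X Y => by rw [hΩ, hΩ, symm])
    (fun X v hv w hw => by rw [hΩ, hadj]; exact normal X v hv w hw)
    (fun X Y Y' hX hY hY' hYY' w hw => by
      rw [hΩ, hΩ, ← map_smul, ← map_sub, hadj]
      exact second X Y Y' hX hY hY' hYY' w hw)
  ext v : 1
  have h := congrArg (fun L => L v) (key X)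
  exact hinj (h.trans (map_zero adj).symm)

namespace PseudohermitianSubmanifold

variable {m n : ℕ} {M : Type*} [TopologicalSpace M]
  [ChartedSpace (EuclideanSpace ℝ (Fin (2 * m + 1))) M] [IsManifold (𝓡 (2 * m + 1)) ∞ M]
  {S S' : PseudohermitianSubmanifold m n M}

theorem im_inner_d_eq (hθ : ∀ p X, S'.theta p X = S.theta p X) (p : M)
    (X Y : TangentSpace (𝓡 (2 * m + 1)) p) :
    (⟪(S'.d p X).1, (S'.d p Y).1⟫_ℂ).im = (⟪(S.d p X).1, (S.d p Y).1⟫_ℂ).im := by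
  have hd := S.smooth.mdifferentiable (by norm_num)
  have hd' := S'.smooth.mdifferentiable (by norm_num)
  simp only [d_eq_vderiv, vderiv_eq_fderiv_chart (hd p), vderiv_eq_fderiv_chart (hd' p)]
  refine im_inner_fderiv_eq (contMDiffAt_iff_chart.1 S.smooth.contMDiffAt)
    (contMDiffAt_iff_chart.1 S'.smooth.contMDiffAt) ?_ X Y
  filter_upwards [extChartAt_target_mem_nhds (I := 𝓡 (2 * m + 1)) p] with x hx X
  rw [fderiv_chart hd hx, fderiv_chart hd' hx]
  exact hθ _ _

/-- The imaginary part comes from the pullback of `dΘ`, the real part from the same identity with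
`JY` in place of `Y`. Only `Y` has to be contact, so `X` may be the Reeb direction. -/
theorem inner_d_eq (hθ : ∀ p X, S'.theta p X = S.theta p X)
    (hJ : ∀ p X, S.theta p X = 0 → (S'.d p (S.inducedJ p X)).1 = Complex.I • (S'.d p X).1)
    {p : M} (X : TangentSpace (𝓡 (2 * m + 1)) p) {Y : TangentSpace (𝓡 (2 * m + 1)) p}
    (hY : S.theta p Y = 0) :
    ⟪(S'.d p X).1, (S'.d p Y).1⟫_ℂ = ⟪(S.d p X).1, (S.d p Y).1⟫_ℂ := by
  refine complex_inner_eq_of_im (im_inner_d_eq hθ p X Y) ?_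
  rw [← hJ p Y hY, ← S.fst_inducedJ hY]
  exact im_inner_d_eq hθ p X _

/-- The complex linear isometry of the `(1,0)`-bundles induced by an isomorphism of pseudohermitian
structures. -/
theorem exists_tangent_map
    (hJ : ∀ p X, S.theta p X = 0 → (S'.d p (S.inducedJ p X)).1 = Complex.I • (S'.d p X).1)
    (p : M) : ∃ G : S.holTangent p →ₗ[ℂ] CVec n,
      ∀ (X) (hX : S.theta p X = 0), G ⟨(S.d p X).1, S.fst_mem_holTangent hX⟩ = (S'.d p X).1 := by
  choose f hf hf' using fun v : S.holTangent p => S.exists_of_mem_holTangent v.2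
  -- A contact vector is determined by its `ℂⁿ`-component, so the chosen preimages depend linearly
  -- on `v`.
  have huniq : ∀ (v : S.holTangent p) X, S.theta p X = 0 → (S.d p X).1 = v → f v = X :=
    fun v X hX hXv => S.ext_of_theta ((hf' v).trans hXv.symm) ((hf v).trans hX.symm)
  refine ⟨{ toFun := fun v => (S'.d p (f v)).1, map_add' := fun v w => ?_, map_smul' := ?_ }, ?_⟩
  · rw [huniq (v + w) (f v + f w) (by rw [theta_add, hf, hf, add_zero])
      (by rw [map_add, Prod.fst_add, hf', hf']; rfl), map_add, Prod.fst_add]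
  · intro c v
    -- The scalar `c` acts as `Re c + Im c · J`; the computation applies to both immersions.
    have key : ∀ (T : PseudohermitianSubmanifold m n M),
        (T.d p (S.inducedJ p (f v))).1 = Complex.I • (T.d p (f v)).1 →
        (T.d p (c.re • f v + c.im • S.inducedJ p (f v))).1 = c • (T.d p (f v)).1 := by
      intro T hT
      rw [map_add, map_smul, map_smul, Prod.fst_add, Prod.smul_fst, Prod.smul_fst, hT]
      ext β
      simp only [PiLp.add_apply, PiLp.smul_apply, smul_eq_mul, Complex.real_smul]
      conv_rhs => rw [← Complex.re_add_im c]
      ring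
    rw [huniq (c • v) (c.re • f v + c.im • S.inducedJ p (f v)) ?_ ?_, RingHom.id_apply]
    · exact key S' (hJ p _ (hf v))
    · rw [theta_add, theta_smul, theta_smul, hf, theta_inducedJ S (hf v)]
      ring
    · rw [key S (S.fst_inducedJ (hf v)), hf']
      rfl
  · intro X hX
    simp only [LinearMap.coe_mk, AddHom.coe_mk]
    rw [huniq _ X hX rfl]

/-- The unitary map of the `(1,0)`-bundle of `H_n` assembled from the differential and an isometry
of the normal bundles. -/
theorem exists_isometry (hθ : ∀ p X, S'.theta p X = S.theta p X)
    (hJ : ∀ p X, S.theta p X = 0 → (S'.d p (S.inducedJ p X)).1 = Complex.I • (S'.d p X).1)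
    (p : M) (F : S.normalSpace p →ₗ[ℂ] CVec n) (hF : ∀ v, F v ∈ S'.normalSpace p)
    (hFi : ∀ v w, ⟪F v, F w⟫_ℂ = ⟪(v : CVec n), w⟫_ℂ)
    (hν : F (S.fundamentalVector p) = S'.fundamentalVector p) :
    ∃ U : CVec n →L[ℂ] CVec n, (∀ v w, ⟪U v, U w⟫_ℂ = ⟪v, w⟫_ℂ) ∧
      (∀ X, (S'.d p X).1 = U (S.d p X).1) ∧ ∀ v : S.normalSpace p, U v = F v := by
  obtain ⟨G, hG⟩ := exists_tangent_map hJ p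
  have hGi : ∀ v w, ⟪G v, G w⟫_ℂ = ⟪v, w⟫_ℂ := by
    rintro ⟨v, hv⟩ ⟨w, hw⟩
    obtain ⟨X, hX, rfl⟩ := S.exists_of_mem_holTangent hv
    obtain ⟨Y, hY, rfl⟩ := S.exists_of_mem_holTangent hw
    rw [hG X hX, hG Y hY]
    exact inner_d_eq hθ hJ X hY
  have hGm : ∀ v, G v ∈ S'.holTangent p := by
    rintro ⟨v, hv⟩
    obtain ⟨X, hX, rfl⟩ := S.exists_of_mem_holTangent hv
    rw [hG X hX]
    exact S'.fst_mem_holTangent ((hθ p X).trans hX)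
  let PA : CVec n →ₗ[ℂ] S.holTangent p := (S.holTangent p).orthogonalProjectionOnto
  let PN : CVec n →ₗ[ℂ] S.normalSpace p := (S.normalSpace p).orthogonalProjectionOnto
  have hPA : ∀ a ∈ S.holTangent p, ∀ b ∈ S.normalSpace p, (PA (a + b) : CVec n) = a := by
    intro a ha b hb
    rw [map_add]
    have h1 : PA a = ⟨a, ha⟩ := Submodule.orthogonalProjectionOnto_mem_subspace_eq_self ⟨a, ha⟩
    have h2 : PA b = 0 := Submodule.orthogonalProjectionOnto_eq_zero_iff.2 hb
    rw [h1, h2, add_zero]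
  have hPN : ∀ a ∈ S.holTangent p, ∀ b ∈ S.normalSpace p, (PN (a + b) : CVec n) = b := by
    intro a ha b hb
    rw [map_add]
    have h1 : PN b = ⟨b, hb⟩ := Submodule.orthogonalProjectionOnto_mem_subspace_eq_self ⟨b, hb⟩
    have h2 : PN a = 0 := Submodule.orthogonalProjectionOnto_eq_zero_iff.2
      (Submodule.le_orthogonal_orthogonal _ ha)
    rw [h1, h2, zero_add]
  let U : CVec n →L[ℂ] CVec n := LinearMap.toContinuousLinearMap (G ∘ₗ PA + F ∘ₗ PN)
  have hU : ∀ (a : S.holTangent p) (b : S.normalSpace p), U (a + b : CVec n) = G a + F b := by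
    intro a b
    have h1 : PA (a + b : CVec n) = a := Subtype.ext (hPA a a.2 b b.2)
    have h2 : PN (a + b : CVec n) = b := Subtype.ext (hPN a a.2 b b.2)
    change G (PA (a + b : CVec n)) + F (PN (a + b : CVec n)) = _
    rw [h1, h2]
  have hUF : ∀ v : S.normalSpace p, U v = F v := fun v => by
    have := hU 0 v
    rwa [Submodule.coe_zero, zero_add, map_zero, zero_add] at this
  have hUG : ∀ v : S.holTangent p, U v = G v := fun v => by
    have := hU v 0
    rwa [Submodule.coe_zero, add_zero, map_zero, add_zero] at this
  refine ⟨U, fun v w => ?_, fun X => ?_, hUF⟩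
  · obtain ⟨a, ha, b, hb, rfl⟩ := (S.holTangent p).exists_add_mem_mem_orthogonal v
    obtain ⟨c, hc, e, he, rfl⟩ := (S.holTangent p).exists_add_mem_mem_orthogonal w
    have h1 := hU ⟨a, ha⟩ ⟨b, hb⟩
    have h2 := hU ⟨c, hc⟩ ⟨e, he⟩
    simp only at h1 h2
    rw [h1, h2, inner_add_left, inner_add_right, inner_add_right, inner_add_left, inner_add_right,
      inner_add_right, hGi, hFi,
      Submodule.inner_right_of_mem_orthogonal (hGm _) (hF _),
      Submodule.inner_left_of_mem_orthogonal (hGm _) (hF _),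
      Submodule.inner_right_of_mem_orthogonal ha he,
      Submodule.inner_left_of_mem_orthogonal hc hb]
    rfl
  -- The image of the Reeb vector `R` under `S` is orthogonal to the contact directions, hence so is
  -- its image under `S'` by `inner_d_eq`; uniqueness identifies the latter with the fundamental
  -- vector of `S'`. Every `X` is a contact vector plus a multiple of `R`.
  · obtain ⟨R, hR, hRν⟩ := S.exists_reeb p
    have hR' : (S'.d p R).1 = U (S.d p R).1 := by
      have hm : (S'.d p R).1 ∈ S'.normalSpace p := by
        refine (Submodule.mem_orthogonal' _ _).2 fun v hv => ?_
        obtain ⟨Y, hY, rfl⟩ := S'.exists_of_mem_holTangent hv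
        have hY' := (hθ p Y).symm.trans hY
        rw [inner_d_eq hθ hJ R hY', hRν]
        exact Submodule.inner_left_of_mem_orthogonal (S.fst_mem_holTangent hY')
          (S.fundamentalVector p).2
      rw [hRν, hUF, hν]
      exact congrArg Subtype.val
        (S'.eq_fundamentalVector ⟨_, hm⟩ (S'.d_eq_T_add ((hθ p R).trans hR)))
    have hX0 : S.theta p (X - S.theta p X • R) = 0 := by
      rw [sub_eq_add_neg, ← neg_smul, theta_add, theta_smul, hR]
      ring
    have h1 := hUG ⟨_, S.fst_mem_holTangent hX0⟩
    rw [hG _ hX0] at h1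
    simp only [map_sub, map_smul, Prod.fst_sub, Prod.smul_fst] at h1
    have h2 : U (S.theta p X • (S.d p R).1) = S.theta p X • U (S.d p R).1 :=
      U.map_smul_of_tower _ _
    rw [h2, hR'] at h1
    exact (sub_left_inj.1 h1).symm

theorem mem_holTangent_of_isometry (hθ : ∀ p X, S'.theta p X = S.theta p X)
    {p : M} {U : CVec n →L[ℂ] CVec n} (hU : ∀ X, (S'.d p X).1 = U (S.d p X).1) {v : CVec n}
    (hv : v ∈ S.holTangent p) : U v ∈ S'.holTangent p := by
  obtain ⟨X, hX, rfl⟩ := S.exists_of_mem_holTangent hv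
  rw [← hU]
  exact S'.fst_mem_holTangent ((hθ p X).trans hX)

theorem mem_normalSpace_of_isometry (hθ : ∀ p X, S'.theta p X = S.theta p X)
    {p : M} {U : CVec n →L[ℂ] CVec n} (hU : ∀ X, (S'.d p X).1 = U (S.d p X).1)
    (hi : ∀ v w, ⟪U v, U w⟫_ℂ = ⟪v, w⟫_ℂ) {v : CVec n}
    (hv : v ∈ S.normalSpace p) : U v ∈ S'.normalSpace p := by
  refine (Submodule.mem_orthogonal _ _).2 fun w hw => ?_
  obtain ⟨X, hX, rfl⟩ := S'.exists_of_mem_holTangent hw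
  rw [hU, hi]
  exact Submodule.inner_right_of_mem_orthogonal
    (S.fst_mem_holTangent ((hθ p X).symm.trans hX)) hv

theorem starProjection_isometry (hθ : ∀ p X, S'.theta p X = S.theta p X)
    {p : M} {U : CVec n →L[ℂ] CVec n} (hU : ∀ X, (S'.d p X).1 = U (S.d p X).1)
    (hi : ∀ v w, ⟪U v, U w⟫_ℂ = ⟪v, w⟫_ℂ) (v : CVec n) :
    (S'.holTangent p).starProjection (U v) = U ((S.holTangent p).starProjection v) := by
  refine Submodule.eq_starProjection_of_mem_of_inner_eq_zero
    (mem_holTangent_of_isometry hθ hU (Submodule.starProjection_apply_mem _ _)) fun w hw => ?_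
  rw [← map_sub]
  exact Submodule.inner_left_of_mem_orthogonal hw (mem_normalSpace_of_isometry hθ hU hi
    (Submodule.sub_starProjection_mem_orthogonal v))

theorem normalSpace_starProjection (S : PseudohermitianSubmanifold m n M) (p : M) (v : CVec n) :
    (S.normalSpace p).starProjection v = v - (S.holTangent p).starProjection v := by
  rw [normalSpace, Submodule.starProjection_orthogonal_val]

/-- On a contact frame `U` yields the differential of `S'`, and on projected normal vectors it is
smooth by assumption. Both kinds of vectors are assembled into a smooth `L` with `L p = 1`; then `U
L` is smooth and `U = (U L) L⁻¹` near `p`. -/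
theorem contMDiff_isometry
    {U : M → CVec n →L[ℂ] CVec n} (hU : ∀ p X, (S'.d p X).1 = U p (S.d p X).1)
    (hN : ∀ v, ContMDiff (𝓡 (2 * m + 1)) 𝓘(ℝ, CVec n) ∞
      (fun q => U q ((S.normalSpace q).starProjection v))) :
    ContMDiff (𝓡 (2 * m + 1)) 𝓘(ℝ, CVec n →L[ℂ] CVec n) ∞ U := by
  intro p
  obtain ⟨b, s, hs, -, hsm⟩ := S.exists_contact_frame p
  set P := (S.normalSpace p).starProjection with hP
  let L : M → CVec n →L[ℂ] CVec n := fun q =>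
    ∑ i, (innerSL ℂ (b i)).smulRight (S.d q (s i q)).1 + (P - (S.holTangent q).starProjection * P)
  let L' : M → CVec n →L[ℂ] CVec n := fun q => U q * L q
  have hL : ContMDiffAt (𝓡 (2 * m + 1)) 𝓘(ℝ, CVec n →L[ℂ] CVec n) ∞ L p := by
    refine ContMDiffAt.add (contMDiffAt_finsetSum fun i _ => ?_) (contMDiffAt_const.sub ?_)
    · exact ((contDiff_innerSL_smulRight (b i)).comp contDiff_fst).contDiffAt.comp_contMDiffAt
        (hsm S S.smooth i)
    · exact (contDiffAt_id.complex_clm_mul contDiffAt_const).comp_contMDiffAt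
        S.contMDiff_starProjection.contMDiffAt
  have hLp : L p = 1 := by
    simp only [L, hs]
    ext v : 1
    simp [hP, normalSpace_starProjection, Submodule.starProjection_eq_self_iff.2
      (Submodule.starProjection_apply_mem (S.holTangent p) v)]
  have hL' : ContMDiffAt (𝓡 (2 * m + 1)) 𝓘(ℝ, CVec n →L[ℂ] CVec n) ∞ L' p := by
    refine contMDiffAt_complex_clm_iff.2 fun v => ?_
    have h1 : (fun q => L' q v) = fun q => ∑ i, ⟪b i, v⟫_ℂ • (S'.d q (s i q)).1 +
        U q ((S.normalSpace q).starProjection (P v)) := by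
      funext q
      simp only [L', L, hU, normalSpace_starProjection]
      simp [map_sum]
    rw [h1]
    refine ContMDiffAt.add (contMDiffAt_finsetSum fun i _ => ?_) (hN (P v)).contMDiffAt
    exact (contDiff_fst.const_smul (⟪b i, v⟫_ℂ)).contDiffAt.comp_contMDiffAt
      (hsm S' S'.smooth i)
  have hinv : ContDiffAt ℝ ∞ (Ring.inverse : (CVec n →L[ℂ] CVec n) → _) (L p) := by
    rw [hLp]
    exact contDiffAt_real_ringInverse 1
  have h2 : ContMDiffAt (𝓡 (2 * m + 1)) 𝓘(ℝ, CVec n →L[ℂ] CVec n) ∞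
      (fun q => L' q * Ring.inverse (L q)) p :=
    (ContDiffAt.complex_clm_mul contDiffAt_fst contDiffAt_snd).comp_contMDiffAt
      (hL'.prodMk_space (hinv.comp_contMDiffAt hL))
  refine h2.congr_of_eventuallyEq ?_
  have h3 : ∀ᶠ q in 𝓝 p, IsUnit (L q) :=
    hL.continuousAt.eventually_mem (Units.isOpen.mem_nhds (hLp ▸ isUnit_one))
  filter_upwards [h3] with q hq
  simp only [L']
  rw [mul_assoc, Ring.mul_inverse_cancel _ hq, mul_one]

theorem vderiv_isometry_symm
    {U : M → CVec n →L[ℂ] CVec n} (hU : ∀ p X, (S'.d p X).1 = U p (S.d p X).1)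
    (hsm : ContMDiff (𝓡 (2 * m + 1)) 𝓘(ℝ, CVec n →L[ℂ] CVec n) ∞ U) (p : M)
    (X Y : TangentSpace (𝓡 (2 * m + 1)) p) :
    vderiv U p X (S.d p Y).1 = vderiv U p Y (S.d p X).1 := by
  have hd := S.contMDiff_fst.mdifferentiable (by norm_num)
  have hd' := S'.contMDiff_fst.mdifferentiable (by norm_num)
  simp only [← vderiv_fst, vderiv_eq_fderiv_chart (hd p),
    vderiv_eq_fderiv_chart (hsm.mdifferentiable (by norm_num) p)]
  refine fderiv_symm_of_fderiv_eq (contMDiffAt_iff_chart.1 S.contMDiff_fst.contMDiffAt)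
    (contMDiffAt_iff_chart.1 S'.contMDiff_fst.contMDiffAt)
    ((contMDiffAt_iff_chart.1 hsm.contMDiffAt).differentiableAt (by norm_num)) ?_ X Y
  filter_upwards [extChartAt_target_mem_nhds (I := 𝓡 (2 * m + 1)) p] with x hx X
  rw [fderiv_chart hd hx, fderiv_chart hd' hx, vderiv_fst, vderiv_fst]
  exact hU _ _

omit [IsManifold (𝓡 (2 * m + 1)) ∞ M] in
theorem vderiv_isometry_skew
    {U : M → CVec n →L[ℂ] CVec n} (hi : ∀ p v w, ⟪U p v, U p w⟫_ℂ = ⟪v, w⟫_ℂ)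
    (hsm : ContMDiff (𝓡 (2 * m + 1)) 𝓘(ℝ, CVec n →L[ℂ] CVec n) ∞ U) (p : M)
    (X : TangentSpace (𝓡 (2 * m + 1)) p) (v w : CVec n) :
    ⟪vderiv U p X v, U p w⟫_ℂ + ⟪U p v, vderiv U p X w⟫_ℂ = 0 := by
  simp only [vderiv_eq_fderiv_chart (hsm.mdifferentiable (by norm_num) p)]
  have h := inner_fderiv_skew (U := U ∘ (extChartAt (𝓡 (2 * m + 1)) p).symm)
    (x := extChartAt (𝓡 (2 * m + 1)) p p)
    ((contMDiffAt_iff_chart.1 hsm.contMDiffAt).differentiableAt (by norm_num))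
    (Filter.Eventually.of_forall fun x => hi _) X v w
  simp only [Function.comp_apply, extChartAt_to_inv] at h
  exact h

/-- The rigidity theorem in terms of the unitary map between the `(1,0)`-bundles of `H_n`. -/
theorem vderiv_isometry_eq_zero
    {U : M → CVec n →L[ℂ] CVec n} (hU : ∀ p X, (S'.d p X).1 = U p (S.d p X).1)
    (hi : ∀ p v w, ⟪U p v, U p w⟫_ℂ = ⟪v, w⟫_ℂ)
    (hsm : ContMDiff (𝓡 (2 * m + 1)) 𝓘(ℝ, CVec n →L[ℂ] CVec n) ∞ U) (p : M)
    (normal : ∀ X : TangentSpace (𝓡 (2 * m + 1)) p, ∀ v ∈ S.normalSpace p, ∀ w ∈ S.normalSpace p,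
      ⟪U p w, vderiv U p X v⟫_ℂ = 0)
    (second : ∀ X Y, S.theta p X = 0 → S.theta p Y = 0 → ∀ w ∈ S.normalSpace p,
      ⟪U p w, vderiv U p Y (S.d p X).1 -
        Complex.I • vderiv U p (S.inducedJ p Y) (S.d p X).1⟫_ℂ = 0) :
    vderiv (d := 2 * m + 1) U p = 0 := by
  obtain ⟨R, hR, -⟩ := S.exists_reeb p
  ext X : 1
  refine isometry_derivative_eq_zero (S.holTangent p) (S.thetaLM p) (fun X => (S.d p X).1) (U p)
    (vderiv U p).toLinearMap R (hi p) (fun v hv => S.exists_of_mem_holTangent hv)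
    (fun X hX => S.fst_mem_holTangent hX) hR (vderiv_isometry_skew hi hsm p)
    (vderiv_isometry_symm hU hsm p) normal (fun X Y Y' hX hY hY' hYY' w hw => ?_) X
  have : Y' = S.inducedJ p Y := S.ext_of_theta (hYY'.trans (S.fst_inducedJ hY).symm)
    (Eq.trans hY' (S.theta_inducedJ hY).symm)
  rw [this]
  exact second X Y hX hY w hw

end PseudohermitianSubmanifold

/-! ### Rigid motions of the Heisenberg group -/

namespace Heis

variable {n : ℕ}

/-- The linear part of a rigid motion. -/
def rigidLinear (e : CVec n ≃ₗᵢ[ℂ] CVec n) (b : CVec n) : Heis n →L[ℝ] Heis n :=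
  LinearMap.toContinuousLinearMap
    { toFun := fun X => (e X.1, X.2 - (⟪b, e X.1⟫_ℂ).im)
      map_add' := fun X Y => Prod.ext (by simp) (by simp; ring)
      map_smul' := fun c X => by
        have h : e (c • X.1) = c • e X.1 := e.toLinearEquiv.toLinearMap.map_smul_of_tower c X.1
        refine Prod.ext h ?_
        simp [h, inner_smul_right_eq_smul, mul_sub] }

theorem rigidLinear_apply (e : CVec n ≃ₗᵢ[ℂ] CVec n) (b : CVec n) (X : Heis n) :
    rigidLinear e b X = (e X.1, X.2 - (⟪b, e X.1⟫_ℂ).im) := rfl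

/-- The rigid motion `(z, t) ↦ (e z + b, t - Im ⟪b, e z⟫ + c)`. -/
def rigidMotion (e : CVec n ≃ₗᵢ[ℂ] CVec n) (b : CVec n) (c : ℝ) :
    Diffeomorph 𝓘(ℝ, Heis n) 𝓘(ℝ, Heis n) (Heis n) (Heis n) ∞ where
  toFun p := rigidLinear e b p + (b, c)
  invFun p := rigidLinear e.symm (-e.symm b) (p - (b, c))
  left_inv p := by
    refine Prod.ext ?_ ?_
    · simp [rigidLinear_apply]
    · have h := e.inner_map_map (e.symm b) p.1
      rw [e.apply_symm_apply] at h
      simp [rigidLinear_apply, h]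
  right_inv p := by
    refine Prod.ext ?_ ?_
    · simp [rigidLinear_apply]
    · have h := e.symm.inner_map_map b p.1
      simp [rigidLinear_apply, h]
      ring
  contMDiff_toFun := ((rigidLinear e b).contDiff.add contDiff_const).contMDiff
  contMDiff_invFun :=
    ((rigidLinear e.symm (-e.symm b)).contDiff.comp (contDiff_id.sub contDiff_const)).contMDiff

theorem rigidMotion_apply (e : CVec n ≃ₗᵢ[ℂ] CVec n) (b : CVec n) (c : ℝ) (p : Heis n) :
    rigidMotion e b c p = (e p.1 + b, p.2 - (⟪b, e p.1⟫_ℂ).im + c) := rfl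

theorem fderiv_rigidMotion (e : CVec n ≃ₗᵢ[ℂ] CVec n) (b : CVec n) (c : ℝ) (p : Heis n) :
    fderiv ℝ (rigidMotion e b c) p = rigidLinear e b :=
  ((rigidLinear e b).hasFDerivAt.add_const (b, c)).fderiv

theorem isRigidMotion_rigidMotion (e : CVec n ≃ₗᵢ[ℂ] CVec n) (b : CVec n) (c : ℝ) :
    IsRigidMotion (rigidMotion e b c) := by
  have h : ∀ p X : Heis n, contactForm (rigidMotion e b c p)
      (fderiv ℝ (rigidMotion e b c) p X) = contactForm p X := by
    intro p X
    rw [fderiv_rigidMotion, rigidLinear_apply, rigidMotion_apply]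
    simp only [contactForm_eq_inner, inner_add_left, e.inner_map_map, Complex.add_im]
    ring
  refine ⟨h, fun p X hX => ?_⟩
  refine ext_contactForm (p := rigidMotion e b c p) ?_ ?_
  · rw [fderiv_rigidMotion]
    simp [rigidLinear_apply, J]
  · rw [h, J, J, contactForm_hlift, contactForm_hlift]

/-- The contact form as a linear form on a tangent space. -/
def contactFormLM (p : Heis n) : Heis n →ₗ[ℝ] ℝ where
  toFun := contactForm p
  map_add' := contactForm_add p
  map_smul' c X := contactForm_smul p X c

theorem exists_isometry_fderiv
    {Φ : Diffeomorph 𝓘(ℝ, Heis n) 𝓘(ℝ, Heis n) (Heis n) (Heis n) ∞} (h : IsRigidMotion Φ)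
    (q : Heis n) : ∃ U : CVec n →L[ℂ] CVec n, (∀ v w, ⟪U v, U w⟫_ℂ = ⟪v, w⟫_ℂ) ∧
      ∀ X, (fderiv ℝ Φ q X).1 = U X.1 := by
  have hs : ContDiff ℝ ∞ Φ := Φ.contMDiff.contDiff
  have him : ∀ X Y, (⟪(fderiv ℝ Φ q X).1, (fderiv ℝ Φ q Y).1⟫_ℂ).im = (⟪X.1, Y.1⟫_ℂ).im := by
    intro X Y
    have := im_inner_fderiv_eq (f := id) (x := q) contDiffAt_id hs.contDiffAt
      (Filter.Eventually.of_forall fun y X => by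
        rw [fderiv_id]; exact h.contactForm_eq y X) X Y
    rwa [fderiv_id] at this
  have hT : (fderiv ℝ Φ q (T n)).1 = 0 := by
    -- Since `dΦ` is onto, some `Y` maps to `i` times the `ℂⁿ`-component `a` of `dΦ(T)`. As `T` is
    -- in the kernel of the pulled back form, `‖a‖² = Im ⟪a, i a⟫ = 0`.
    obtain ⟨Y, hY⟩ : ∃ Y, fderiv ℝ Φ q Y = (Complex.I • (fderiv ℝ Φ q (T n)).1, 0) := by
      have h1 : (fderiv ℝ Φ q).comp (fderiv ℝ Φ.symm (Φ q)) = ContinuousLinearMap.id ℝ (Heis n) := by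
        have h2 : (Φ : Heis n → Heis n) ∘ Φ.symm = id := funext Φ.apply_symm_apply
        have h3 := fderiv_comp (Φ q)
          (hs.differentiable (by norm_num) (Φ.symm (Φ q)))
          (Φ.symm.contMDiff.contDiff.differentiable (by norm_num) (Φ q))
        rw [h2, fderiv_id, Φ.symm_apply_apply] at h3
        exact h3.symm
      exact ⟨_, congrArg (fun L => L (Complex.I • (fderiv ℝ Φ q (T n)).1, 0)) h1⟩
    have h1 := him (T n) Y
    rw [hY] at h1
    simp only [inner_smul_right, Complex.I_mul_im, T, inner_zero_left, Complex.zero_im] at h1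
    have h2 : (⟪(fderiv ℝ Φ q (T n)).1, (fderiv ℝ Φ q (T n)).1⟫_ℂ).re = 0 := h1
    rw [← RCLike.re_eq_complex_re, inner_self_eq_norm_sq] at h2
    exact norm_eq_zero.1 (by simpa using h2)
  have hX : ∀ X : Heis n, (fderiv ℝ Φ q X).1 = (fderiv ℝ Φ q (hlift q X.1)).1 := by
    intro X
    conv_lhs => rw [eq_hlift_add q X, map_add, map_smul, Prod.fst_add, Prod.smul_fst, hT,
      smul_zero, add_zero]
  have hJ : ∀ v, (fderiv ℝ Φ q (hlift q (Complex.I • v))).1 =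
      Complex.I • (fderiv ℝ Φ q (hlift q v)).1 := by
    intro v
    have h1 := h.map_J q (hlift q v) (contactForm_hlift q v)
    have h2 := congrArg Prod.fst h1
    simpa only [J, hlift_fst] using h2
  let U : CVec n →ₗ[ℂ] CVec n :=
    { toFun := fun v => (fderiv ℝ Φ q (hlift q v)).1
      map_add' := fun v w => by rw [hlift_add, map_add, Prod.fst_add]
      map_smul' := fun c v => by
        have h1 : c • v = c.re • v + c.im • Complex.I • v := by
          conv_lhs => rw [← Complex.re_add_im c]
          rw [add_smul, mul_smul]
          rfl
        rw [h1, hlift_add, hlift_smul, hlift_smul, map_add, map_smul, map_smul, Prod.fst_add,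
          Prod.smul_fst, Prod.smul_fst, hJ, RingHom.id_apply]
        conv_rhs => rw [← Complex.re_add_im c]
        rw [add_smul, mul_smul]
        rfl }
  refine ⟨LinearMap.toContinuousLinearMap U, fun v w => complex_inner_eq_of_im ?_ ?_, hX⟩
  · exact him (hlift q v) (hlift q w)
  · rw [← map_smul]
    exact him (hlift q v) (hlift q (Complex.I • w))

/-- The differential of a rigid motion acts on the left invariant frame by a constant unitary
matrix. -/
theorem IsRigidMotion.exists_linearIsometryEquiv
    {Φ : Diffeomorph 𝓘(ℝ, Heis n) 𝓘(ℝ, Heis n) (Heis n) (Heis n) ∞} (h : IsRigidMotion Φ) :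
    ∃ e : CVec n ≃ₗᵢ[ℂ] CVec n, ∀ q X, (fderiv ℝ Φ q X).1 = e X.1 := by
  choose U hi hU using exists_isometry_fderiv h
  have hs : ContDiff ℝ ∞ Φ := Φ.contMDiff.contDiff
  have hsm : ContDiff ℝ ∞ U := by
    let b := stdOrthonormalBasis ℂ (CVec n)
    have h1 : U = fun q => ∑ i, (innerSL ℂ (b i)).smulRight (U q (b i)) :=
      funext fun q => sum_inner_smulRight b (U q)
    rw [h1]
    refine ContDiff.sum fun i _ => (contDiff_innerSL_smulRight (b i)).comp ?_
    have h2 : (fun q => U q (b i)) = fun q => (fderiv ℝ Φ q (b i, 0)).1 :=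
      funext fun q => (hU q (b i, 0)).symm
    rw [h2]
    exact ((hs.fderiv_right (m := ∞) (by norm_cast)).clm_apply contDiff_const).fst
  have hd : Differentiable ℝ U := hsm.differentiable (by norm_num)
  have hzero : ∀ q, fderiv ℝ U q = 0 := by
    intro q
    refine ContinuousLinearMap.ext fun X => ?_
    -- Here `A = ⊤` and `T` is the Reeb vector; the normal conditions are vacuous because `⊤ᗮ = 0`.
    refine isometry_derivative_eq_zero ⊤ (contactFormLM q) Prod.fst (U q)
      (fderiv ℝ U q).toLinearMap (T n) (hi q)
      (fun v _ => ⟨hlift q v, contactForm_hlift q v, rfl⟩) (fun _ _ => trivial) (contactForm_T q)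
      (fun X v w => inner_fderiv_skew (hd q) (Filter.Eventually.of_forall hi) X v w)
      (fun X Y => ?_) ?_ ?_ X
    · have h1 := fderiv_symm_of_fderiv_eq (z := (Prod.fst : Heis n → CVec n))
        (z' := fun p => (Φ p).1) contDiffAt_fst hs.fst.contDiffAt (hd q)
        (Filter.Eventually.of_forall fun p X => by
          rw [fderiv_fst, fderiv.fst (hs.differentiable (by norm_num) p)]
          exact hU p X) X Y
      rwa [fderiv_fst] at h1
    · intro X v _ w hw
      rw [Submodule.top_orthogonal_eq_bot, Submodule.mem_bot] at hw
      rw [hw, map_zero, inner_zero_left]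
    · intro X Y Y' _ _ _ _ w hw
      rw [Submodule.top_orthogonal_eq_bot, Submodule.mem_bot] at hw
      rw [hw, map_zero, inner_zero_left]
  have hconst := is_const_of_fderiv_eq_zero hd hzero
  let L : CVec n →ₗᵢ[ℂ] CVec n := (U 0).toLinearMap.isometryOfInner (hi 0)
  refine ⟨L.toLinearIsometryEquiv rfl, fun q X => ?_⟩
  rw [hU, hconst q 0]
  rfl

end Heis

/-! ### Pullback along a diffeomorphism and comparison of the invariants -/

namespace PseudohermitianSubmanifold

variable {m n : ℕ} {M : Type*} [TopologicalSpace M]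
  [ChartedSpace (EuclideanSpace ℝ (Fin (2 * m + 1))) M] [IsManifold (𝓡 (2 * m + 1)) ∞ M]
  {N : Type*} [TopologicalSpace N]
  [ChartedSpace (EuclideanSpace ℝ (Fin (2 * m + 1))) N] [IsManifold (𝓡 (2 * m + 1)) ∞ N]

omit [IsManifold (𝓡 (2 * m + 1)) ∞ M] [IsManifold (𝓡 (2 * m + 1)) ∞ N] in
theorem bijective_mfderiv_diffeomorph
    (φ : Diffeomorph (𝓡 (2 * m + 1)) (𝓡 (2 * m + 1)) M N ∞) (p : M) :
    Function.Bijective (mfderiv (𝓡 (2 * m + 1)) (𝓡 (2 * m + 1)) φ p) := by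
  have h := (φ.mfderivToContinuousLinearEquiv (by norm_num) p).bijective
  have h2 := φ.mfderivToContinuousLinearEquiv_coe (x := p) (by norm_num)
  rw [← h2]
  exact h

omit [IsManifold (𝓡 (2 * m + 1)) ∞ M] [IsManifold (𝓡 (2 * m + 1)) ∞ N] in
theorem vderiv_comp_diffeomorph {W : Type*} [NormedAddCommGroup W] [NormedSpace ℝ W]
    (φ : Diffeomorph (𝓡 (2 * m + 1)) (𝓡 (2 * m + 1)) M N ∞) {g : N → W} {p : M}
    (hg : ContMDiffAt (𝓡 (2 * m + 1)) 𝓘(ℝ, W) ∞ g (φ p)) (X : TangentSpace (𝓡 (2 * m + 1)) p) :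
    vderiv (fun q => g (φ q)) p X =
      vderiv g (φ p) (mfderiv (𝓡 (2 * m + 1)) (𝓡 (2 * m + 1)) φ p X) :=
  vderiv_comp (hg.mdifferentiableAt (by norm_num)) (φ.mdifferentiable (by norm_num) p) X

/-- The composition of a pseudohermitian submanifold with a diffeomorphism. -/
def comp (S' : PseudohermitianSubmanifold m n N)
    (φ : Diffeomorph (𝓡 (2 * m + 1)) (𝓡 (2 * m + 1)) M N ∞) : PseudohermitianSubmanifold m n M where
  toFun p := S' (φ p)
  smooth := S'.smooth.comp φ.contMDiff
  immersion p X Y h := (bijective_mfderiv_diffeomorph φ p).1 <| S'.d_injective (φ p) <|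
    (vderiv_comp_diffeomorph φ S'.smooth.contMDiffAt X).symm.trans
      (h.trans (vderiv_comp_diffeomorph φ S'.smooth.contMDiffAt Y))
  transverse p := by
    obtain ⟨X', hX'⟩ := S'.transverse (φ p)
    obtain ⟨X, rfl⟩ := (bijective_mfderiv_diffeomorph φ p).2 X'
    refine ⟨X, fun h => hX' ?_⟩
    exact (congrArg (contactForm (S' (φ p)))
      (vderiv_comp_diffeomorph φ S'.smooth.contMDiffAt X)).symm.trans h
  J_invariant p X hX := by
    have h1 := vderiv_comp_diffeomorph φ (S'.smooth.contMDiffAt (x := φ p)) X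
    obtain ⟨Y', hY'⟩ := S'.J_invariant (φ p) _
      ((congrArg (contactForm (S' (φ p))) h1).symm.trans hX)
    obtain ⟨Y, rfl⟩ := (bijective_mfderiv_diffeomorph φ p).2 Y'
    refine ⟨Y, ?_⟩
    exact (vderiv_comp_diffeomorph φ S'.smooth.contMDiffAt Y).trans
      (hY'.trans (congrArg (J (S' (φ p))) h1).symm)

variable (S : PseudohermitianSubmanifold m n M) (S' : PseudohermitianSubmanifold m n N)
  (φ : Diffeomorph (𝓡 (2 * m + 1)) (𝓡 (2 * m + 1)) M N ∞)

theorem comp_apply (p : M) : S'.comp φ p = S' (φ p) := rfl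

theorem comp_d (p : M) (X : TangentSpace (𝓡 (2 * m + 1)) p) :
    (S'.comp φ).d p X = S'.d (φ p) (mfderiv (𝓡 (2 * m + 1)) (𝓡 (2 * m + 1)) φ p X) :=
  vderiv_comp_diffeomorph φ S'.smooth.contMDiffAt X

theorem comp_theta (p : M) (X : TangentSpace (𝓡 (2 * m + 1)) p) :
    (S'.comp φ).theta p X = S'.theta (φ p) (mfderiv (𝓡 (2 * m + 1)) (𝓡 (2 * m + 1)) φ p X) :=
  congrArg (contactForm (S' (φ p))) (S'.comp_d φ p X)

theorem comp_holTangent (p : M) : (S'.comp φ).holTangent p = S'.holTangent (φ p) := by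
  ext v
  constructor
  · rintro ⟨X, hX⟩
    exact ⟨_, (S'.comp_d φ p X).symm.trans hX⟩
  · rintro ⟨X', hX'⟩
    obtain ⟨X, rfl⟩ := (bijective_mfderiv_diffeomorph φ p).2 X'
    exact ⟨X, (S'.comp_d φ p X).trans hX'⟩

theorem comp_normalSpace (p : M) : (S'.comp φ).normalSpace p = S'.normalSpace (φ p) := by
  rw [normalSpace, normalSpace, comp_holTangent]

theorem comp_fundamentalVector (p : M) :
    ((S'.comp φ).fundamentalVector p : CVec n) = S'.fundamentalVector (φ p) := by
  obtain ⟨R, hR⟩ := (S'.comp φ).exists_d_eq_T_add p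
  rw [comp_d] at hR
  have hm : ((S'.comp φ).fundamentalVector p : CVec n) ∈ S'.normalSpace (φ p) :=
    comp_normalSpace S' φ p ▸ ((S'.comp φ).fundamentalVector p).2
  exact congrArg Subtype.val (S'.eq_fundamentalVector ⟨_, hm⟩ hR)

theorem coe_normalProj (p : M) (v : CVec n) :
    (S.normalProj p v : CVec n) = v - (S.holTangent p).starProjection v := by
  rw [← normalSpace_starProjection, Submodule.starProjection_apply]
  rfl

theorem inner_normalProj {p : M} {w : CVec n} (hw : w ∈ S.normalSpace p) (v : CVec n) :
    ⟪w, (S.normalProj p v : CVec n)⟫_ℂ = ⟪w, v⟫_ℂ := by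
  rw [coe_normalProj, inner_sub_right, Submodule.inner_left_of_mem_orthogonal
    (Submodule.starProjection_apply_mem (S.holTangent p) v) hw, sub_zero]

omit [IsManifold (𝓡 (2 * m + 1)) ∞ M] in
theorem nabla_eq_vderiv (p : M) (X : TangentSpace (𝓡 (2 * m + 1)) p) (W : M → CVec n) :
    nabla p X W = vderiv W p X := rfl

theorem contMDiff_extend (v : CVec n) :
    ContMDiff (𝓡 (2 * m + 1)) 𝓘(ℝ, CVec n) ∞ (S.extend v) := fun p =>
  (S.contMDiff_starProjection p).complex_clm_apply contMDiffAt_const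

variable {S S'} {φ}

section Isometry

variable (hθ : ∀ p X, (S'.comp φ).theta p X = S.theta p X) {U : M → CVec n →L[ℂ] CVec n}
  (hU : ∀ p X, ((S'.comp φ).d p X).1 = U p (S.d p X).1)
  (hi : ∀ p v w, ⟪U p v, U p w⟫_ℂ = ⟪v, w⟫_ℂ)
  (hsm : ContMDiff (𝓡 (2 * m + 1)) 𝓘(ℝ, CVec n →L[ℂ] CVec n) ∞ U)

include hθ hU hi

theorem mem_normalSpace_comp {p : M} {w : CVec n} (hw : w ∈ S.normalSpace p) :
    U p w ∈ S'.normalSpace (φ p) :=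
  comp_normalSpace S' φ p ▸ mem_normalSpace_of_isometry hθ (hU p) (hi p) hw

theorem starProjection_comp (p : M) (v : CVec n) :
    (S'.holTangent (φ p)).starProjection (U p v) =
      U p ((S.holTangent p).starProjection v) := by
  have h := starProjection_isometry hθ (hU p) (hi p) v
  simp only [comp_holTangent] at h
  exact h

theorem normalProj_comp (p : M) (v : CVec n) :
    (S'.normalProj (φ p) (U p v) : CVec n) = U p (S.normalProj p v) := by
  rw [coe_normalProj, coe_normalProj, starProjection_comp hθ hU hi, map_sub]

include hsm

/-- The derivative of the extension of a tangent vector, in normal directions. -/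
theorem inner_vderiv_extend {p : M} {v w : CVec n} (hv : v ∈ S.holTangent p)
    (hw : w ∈ S.normalSpace p) (Y : TangentSpace (𝓡 (2 * m + 1)) p) :
    ⟪U p w, vderiv (S'.extend (U p v)) (φ p)
        (mfderiv (𝓡 (2 * m + 1)) (𝓡 (2 * m + 1)) φ p Y)⟫_ℂ =
      ⟪U p w, vderiv U p Y v⟫_ℂ + ⟪w, vderiv (S.extend v) p Y⟫_ℂ := by
  rw [← vderiv_comp_diffeomorph φ (S'.contMDiff_extend _).contMDiffAt]
  have hW := S.contMDiff_extend v
  have hW' : ContMDiff (𝓡 (2 * m + 1)) 𝓘(ℝ, CVec n) ∞ (fun q => S'.extend (U p v) (φ q)) :=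
    (S'.contMDiff_extend (U p v)).comp φ.contMDiff
  have hUW : ContMDiff (𝓡 (2 * m + 1)) 𝓘(ℝ, CVec n) ∞ (fun q => U q (S.extend v q)) := fun q =>
    (hsm q).complex_clm_apply (hW q)
  have hP : ContMDiff (𝓡 (2 * m + 1)) 𝓘(ℝ, CVec n →L[ℂ] CVec n) ∞
      (fun q => (S'.holTangent (φ q)).starProjection) :=
    S'.contMDiff_starProjection.comp φ.contMDiff
  -- Both terms are (1,0)-tangential and agree at `p`. Differentiating `P D = D` where `D p = 0`
  -- gives `dD = P dD`, so the normal parts of the two derivatives coincide.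
  let D : M → CVec n := fun q => S'.extend (U p v) (φ q) - U q (S.extend v q)
  have hD : ContMDiff (𝓡 (2 * m + 1)) 𝓘(ℝ, CVec n) ∞ D := hW'.sub hUW
  have hvp : S.extend v p = v := Submodule.starProjection_eq_self_iff.2 hv
  have hDp : D p = 0 := by
    simp only [D, hvp]
    rw [extend, starProjection_comp hθ hU hi, Submodule.starProjection_eq_self_iff.2 hv, sub_self]
  have hPD : (fun q => (S'.holTangent (φ q)).starProjection (D q)) = D := by
    funext q
    refine Submodule.starProjection_eq_self_iff.2 (Submodule.sub_mem _ ?_ ?_)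
    · exact Submodule.starProjection_apply_mem _ _
    · have := mem_holTangent_of_isometry hθ (hU q)
        (Submodule.starProjection_apply_mem (S.holTangent q) v)
      rwa [comp_holTangent] at this
  have h1 := vderiv_complex_clm_apply (hP p) (hD p) Y
  rw [hPD, hDp, map_zero, zero_add] at h1
  have h2 : ⟪U p w, vderiv D p Y⟫_ℂ = 0 := by
    rw [h1]
    exact Submodule.inner_left_of_mem_orthogonal (Submodule.starProjection_apply_mem _ _)
      (mem_normalSpace_comp hθ hU hi hw)
  have h3 : vderiv D p Y = vderiv (fun q => S'.extend (U p v) (φ q)) p Y -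
      vderiv (fun q => U q (S.extend v q)) p Y := by
    have := mfderiv_sub (hW'.mdifferentiable (by norm_num) p) (hUW.mdifferentiable (by norm_num) p)
    exact congrArg (fun L => L Y) this
  rw [h3, vderiv_complex_clm_apply (hsm p) (hW p), hvp, inner_sub_right, inner_add_right, hi] at h2
  exact sub_eq_zero.1 h2

/-- The defect is the normal part of the derivative of `U` along `(Y - i J Y) / 2`. Its vanishing is
the condition `second` of the linear algebra, and it is automatic for constant `U`. -/
theorem inner_secondFundamentalForm_comp {p : M} {X Y : TangentSpace (𝓡 (2 * m + 1)) p}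
    (hX : S.theta p X = 0)
    (hJ : mfderiv (𝓡 (2 * m + 1)) (𝓡 (2 * m + 1)) φ p (S.inducedJ p Y) =
      S'.inducedJ (φ p) (mfderiv (𝓡 (2 * m + 1)) (𝓡 (2 * m + 1)) φ p Y))
    {w : CVec n} (hw : w ∈ S.normalSpace p) :
    ⟪U p w, (S'.secondFundamentalForm (φ p) (mfderiv (𝓡 (2 * m + 1)) (𝓡 (2 * m + 1)) φ p X)
        (mfderiv (𝓡 (2 * m + 1)) (𝓡 (2 * m + 1)) φ p Y) : CVec n)⟫_ℂ =
      ⟪w, (S.secondFundamentalForm p X Y : CVec n)⟫_ℂ + (1 / 2) * ⟪U p w, vderiv U p Y (S.d p X).1 -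
        Complex.I • vderiv U p (S.inducedJ p Y) (S.d p X).1⟫_ℂ := by
  have hv := S.fst_mem_holTangent hX
  rw [secondFundamentalForm, secondFundamentalForm, S.inner_normalProj hw,
    S'.inner_normalProj (mem_normalSpace_comp hθ hU hi hw), ← hJ, ← comp_d, hU]
  have h1 := inner_vderiv_extend hθ hU hi hsm hv hw Y
  have h2 := inner_vderiv_extend hθ hU hi hsm hv hw (S.inducedJ p Y)
  simp only [inner_smul_right, inner_sub_right, nabla_eq_vderiv]
  linear_combination (1 / 2) * h1 - (1 / 2) * Complex.I * h2

/-- Leibniz rule for `U V`, together with the fact that `U` commutes with the normal projections. -/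
theorem normalConnection_comp {p : M} {V : M → CVec n}
    (hV : ContMDiffAt (𝓡 (2 * m + 1)) 𝓘(ℝ, CVec n) ∞ V p) (X : TangentSpace (𝓡 (2 * m + 1)) p) :
    (S'.normalConnection (φ p) (mfderiv (𝓡 (2 * m + 1)) (𝓡 (2 * m + 1)) φ p X)
        (fun r => U (φ.symm r) (V (φ.symm r))) : CVec n) =
      S'.normalProj (φ p) (vderiv U p X (V p)) + U p (S.normalConnection p X V) := by
  have hUV := (hsm p).complex_clm_apply hV
  have hg : ContMDiffAt (𝓡 (2 * m + 1)) 𝓘(ℝ, CVec n) ∞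
      (fun r => U (φ.symm r) (V (φ.symm r))) (φ p) := by
    refine ContMDiffAt.comp (φ p) (g := fun q => U q (V q)) ?_ φ.symm.contMDiff.contMDiffAt
    rwa [φ.symm_apply_apply]
  have h := vderiv_comp_diffeomorph φ hg X
  simp only [φ.symm_apply_apply] at h
  rw [normalConnection, normalConnection]
  change (S'.normalProj (φ p) (vderiv _ (φ p) _) : CVec n) = _ + U p (S.normalProj p (vderiv V p X))
  rw [← h, vderiv_complex_clm_apply (hsm p) hV, ← normalProj_comp hθ hU hi, normalProj, map_add]
  rfl

end Isometry

/-- Preservation of the invariants makes the assembled unitary map constant. -/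
theorem exists_constant_isometry [PreconnectedSpace M] [Nonempty M]
    {F : ∀ p, S.normalSpace p ≃ₗᵢ[ℂ] S'.normalSpace (φ p)} (hF : PreservesInvariants S S' φ F) :
    ∃ e : CVec n ≃ₗᵢ[ℂ] CVec n, ∀ p X, ((S'.comp φ).d p X).1 = e (S.d p X).1 := by
  have hθ : ∀ p X, (S'.comp φ).theta p X = S.theta p X := fun p X =>
    (comp_theta S' φ p X).trans (hF.contactForm_eq p X)
  have hJ : ∀ p X, S.theta p X = 0 →
      ((S'.comp φ).d p (S.inducedJ p X)).1 = Complex.I • ((S'.comp φ).d p X).1 := by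
    intro p X hX
    rw [comp_d, comp_d, hF.map_J p X hX, fst_inducedJ]
    rw [hF.contactForm_eq, hX]
  have hex : ∀ p, ∃ U : CVec n →L[ℂ] CVec n, (∀ v w, ⟪U v, U w⟫_ℂ = ⟪v, w⟫_ℂ) ∧
      (∀ X, ((S'.comp φ).d p X).1 = U (S.d p X).1) ∧
      ∀ v : S.normalSpace p, U v = (F p v : CVec n) := by
    intro p
    refine exists_isometry hθ hJ p
      ((S'.normalSpace (φ p)).subtype ∘ₗ (F p).toLinearEquiv.toLinearMap) (fun v => ?_)
      (fun v w => ?_) ?_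
    · rw [comp_normalSpace]
      exact (F p v).2
    · exact LinearIsometryEquiv.inner_map_map (𝕜 := ℂ) (E := S.normalSpace p)
        (E' := S'.normalSpace (φ p)) (F p) v w
    · rw [comp_fundamentalVector]
      exact congrArg Subtype.val (hF.fundamentalVector_eq p)
  choose U hi hU hUF using hex
  -- Projecting constant vectors gives global smooth normal sections with any prescribed value at a
  -- point, on which the properties of `F` are tested.
  let V : CVec n → ∀ q, S.normalSpace q := fun v q => S.normalProj q v
  have hV : ∀ v, ContMDiff (𝓡 (2 * m + 1)) 𝓘(ℝ, CVec n) ∞ (fun q => (V v q : CVec n)) := by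
    intro v
    simp only [V, coe_normalProj]
    exact contMDiff_const.sub (S.contMDiff_extend v)
  have hVp : ∀ p, ∀ v ∈ S.normalSpace p, (V v p : CVec n) = v := by
    intro p v hv
    simp only [V, normalProj, ← Submodule.starProjection_apply]
    exact Submodule.starProjection_eq_self_iff.2 hv
  have hsm : ContMDiff (𝓡 (2 * m + 1)) 𝓘(ℝ, CVec n →L[ℂ] CVec n) ∞ U := by
    refine contMDiff_isometry hU fun v => ?_
    have h1 := hF.smooth Set.univ (V v) isOpen_univ (hV v).contMDiffOn
    rw [contMDiffOn_univ] at h1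
    refine h1.congr fun q => ?_
    rw [← hUF]
    rfl
  have hzero : ∀ p, vderiv (d := 2 * m + 1) U p = 0 := by
    intro p
    refine vderiv_isometry_eq_zero hU hi hsm p (fun X v hv w hw => ?_)
      (fun X Y hX hY w hw => ?_)
    · have h1 := congrArg Subtype.val
        (hF.normalConnection_eq Set.univ (V v) isOpen_univ (hV v).contMDiffOn p trivial X)
      have h2 := normalConnection_comp hθ hU hi hsm (hV v p) X
      simp only [hUF] at h2
      rw [← h1, hVp p v hv] at h2
      have h3 := right_eq_add.1 h2
      rw [← S'.inner_normalProj (mem_normalSpace_comp hθ hU hi hw), h3, inner_zero_right]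
    · have h1 := hF.secondFundamentalForm_eq p X Y ⟨w, hw⟩ hX hY
      rw [Submodule.coe_inner, Submodule.coe_inner, ← hUF,
        inner_secondFundamentalForm_comp hθ hU hi hsm hX (hF.map_J p Y hY) hw] at h1
      simpa using h1
  obtain ⟨p₀⟩ := ‹Nonempty M›
  let L : CVec n →ₗᵢ[ℂ] CVec n := (U p₀).toLinearMap.isometryOfInner (hi p₀)
  refine ⟨L.toLinearIsometryEquiv rfl, fun p X => ?_⟩
  rw [hU, eq_of_mfderiv_eq_zero hsm hzero p p₀]
  rfl

/-- Two pseudohermitian submanifolds with the same induced contact form whose differentials differ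
by a constant unitary matrix differ by a rigid motion. -/
theorem exists_rigidMotion [PreconnectedSpace M] [Nonempty M]
    {S S' : PseudohermitianSubmanifold m n M}
    (hθ : ∀ p X, S'.theta p X = S.theta p X) (e : CVec n ≃ₗᵢ[ℂ] CVec n)
    (he : ∀ p X, (S'.d p X).1 = e (S.d p X).1) :
    ∃ b c, ∀ p, rigidMotion e b c (S p) = S' p := by
  obtain ⟨p₀⟩ := ‹Nonempty M›
  have hfst : ∀ T : PseudohermitianSubmanifold m n M, ∀ p (X : TangentSpace (𝓡 (2 * m + 1)) p)
      (W : Type) [NormedAddCommGroup W] [NormedSpace ℝ W] (L : Heis n →L[ℝ] W),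
      vderiv (fun q => L (T q)) p X = L (T.d p X) := by
    intro T p X W _ _ L
    have := vderiv_comp_left (g := L) (f := T) (p := p) L.differentiableAt
      (T.smooth.mdifferentiable (by norm_num) p) X
    rw [L.fderiv] at this
    exact this
  have hsub : ∀ (W : Type) [NormedAddCommGroup W] [NormedSpace ℝ W] (L L' : Heis n →L[ℝ] W),
      (∀ p X, L' (S'.d p X) = L (S.d p X)) → ∀ p, L' (S' p) - L (S p) = L' (S' p₀) - L (S p₀) := by
    intro W _ _ L L' h p
    have h1 := L.contDiff.contMDiff.comp S.smooth
    have h2 := L'.contDiff.contMDiff.comp S'.smooth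
    refine eq_of_mfderiv_eq_zero (g := fun p => L' (S' p) - L (S p)) (h2.sub h1) (fun p => ?_) p p₀
    ext X
    have h3 := mfderiv_sub (h2.mdifferentiable (by norm_num) p) (h1.mdifferentiable (by norm_num) p)
    refine (congrArg (fun L => L X) h3).trans ?_
    change vderiv (fun q => L' (S' q)) p X - vderiv (fun q => L (S q)) p X = 0
    rw [hfst, hfst, h, sub_self]
  -- The first component of `rigidLinear` does not involve its translation vector, so `0` serves
  -- until `b` is found.
  have h1 := hsub (CVec n) ((ContinuousLinearMap.fst ℝ (CVec n) ℝ).comp (rigidLinear e 0))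
    (ContinuousLinearMap.fst ℝ (CVec n) ℝ) he
  set b := (S' p₀).1 - e (S p₀).1
  have hb : ∀ p, (S' p).1 = e (S p).1 + b := fun p => sub_eq_iff_eq_add'.1 (h1 p)
  -- Inserting `z' = e z + b` into the equality of contact forms leaves `dt' = dt - Im ⟪b, e dz⟫`.
  have h2 := hsub ℝ ((ContinuousLinearMap.snd ℝ (CVec n) ℝ).comp (rigidLinear e b))
    (ContinuousLinearMap.snd ℝ (CVec n) ℝ) fun p X => by
      have h3 := hθ p X
      simp only [theta, contactForm_eq_inner, he, hb, inner_add_left, e.inner_map_map,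
        Complex.add_im] at h3
      change (S'.d p X).2 = (S.d p X).2 - (⟪b, e (S.d p X).1⟫_ℂ).im
      linarith
  exact ⟨b, _, fun p => Prod.ext (hb p).symm
    ((add_comm _ _).trans (sub_eq_iff_eq_add.1 (h2 p)).symm)⟩

end PseudohermitianSubmanifold

/-! ### Invariance under rigid motions -/

namespace PseudohermitianSubmanifold

variable {m n : ℕ} {M : Type*} [TopologicalSpace M]
  [ChartedSpace (EuclideanSpace ℝ (Fin (2 * m + 1))) M] [IsManifold (𝓡 (2 * m + 1)) ∞ M]
  {N : Type*} [TopologicalSpace N]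
  [ChartedSpace (EuclideanSpace ℝ (Fin (2 * m + 1))) N] [IsManifold (𝓡 (2 * m + 1)) ∞ N]
  {S : PseudohermitianSubmanifold m n M} {S' : PseudohermitianSubmanifold m n N}
  {φ : Diffeomorph (𝓡 (2 * m + 1)) (𝓡 (2 * m + 1)) M N ∞}

theorem finrank_normalSpace (S : PseudohermitianSubmanifold m n M) (p : M) :
    Module.finrank ℂ (S.normalSpace p) = n - m := by
  have h := (S.holTangent p).finrank_add_finrank_orthogonal
  rw [finrank_holTangent, finrank_euclideanSpace_fin] at h
  rw [normalSpace]
  omega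

/-- The isometry of normal spaces obtained by restricting a unitary map. -/
theorem exists_normal_isometry (p : M) (e : CVec n ≃ₗᵢ[ℂ] CVec n)
    (h : ∀ v ∈ S.normalSpace p, e v ∈ S'.normalSpace (φ p)) :
    ∃ F : S.normalSpace p ≃ₗᵢ[ℂ] S'.normalSpace (φ p), ∀ v, (F v : CVec n) = e v := by
  let L : S.normalSpace p →ₗᵢ[ℂ] S'.normalSpace (φ p) :=
    { toLinearMap := e.toLinearEquiv.toLinearMap.restrict h
      norm_map' := fun v => e.norm_map v }
  exact ⟨L.toLinearIsometryEquiv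
    ((S.finrank_normalSpace p).trans (S'.finrank_normalSpace (φ p)).symm), fun v => rfl⟩

/-- Submanifolds that differ by a rigid motion have the same invariants. -/
theorem exists_preservesInvariants
    {Φ : Diffeomorph 𝓘(ℝ, Heis n) 𝓘(ℝ, Heis n) (Heis n) (Heis n) ∞} (hΦ : IsRigidMotion Φ)
    (hφ : ∀ p, Φ (S p) = S' (φ p)) :
    ∃ F : ∀ p, S.normalSpace p ≃ₗᵢ[ℂ] S'.normalSpace (φ p), PreservesInvariants S S' φ F := by
  obtain ⟨e, he⟩ := hΦ.exists_linearIsometryEquiv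
  have hd : ∀ p X, (S'.comp φ).d p X = fderiv ℝ Φ (S p) (S.d p X) := by
    intro p X
    have h1 : (S'.comp φ : M → Heis n) = Φ ∘ S := funext fun q => (hφ q).symm
    rw [d_eq_vderiv, h1]
    exact vderiv_comp_left (Φ.contMDiff.contDiff.differentiable (by norm_num) _)
      (S.smooth.mdifferentiable (by norm_num) p) X
  have hθ : ∀ p X, (S'.comp φ).theta p X = S.theta p X := by
    intro p X
    rw [theta, hd, comp_apply, ← hφ, hΦ.contactForm_eq]
    rfl
  -- A constant family, so every defect term containing `dU` vanishes.
  let U : M → CVec n →L[ℂ] CVec n := fun _ => e.toContinuousLinearEquiv.toContinuousLinearMap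
  have hU : ∀ p X, ((S'.comp φ).d p X).1 = U p (S.d p X).1 := fun p X => by
    rw [hd, he]
    rfl
  have hi : ∀ p v w, ⟪U p v, U p w⟫_ℂ = ⟪v, w⟫_ℂ := fun p v w => e.inner_map_map v w
  have hsm : ContMDiff (𝓡 (2 * m + 1)) 𝓘(ℝ, CVec n →L[ℂ] CVec n) ∞ U := contMDiff_const
  have hU0 : ∀ p, vderiv (d := 2 * m + 1) U p = 0 := fun p => mfderiv_const
  have hJ : ∀ (p : M) (X : TangentSpace (𝓡 (2 * m + 1)) p), S.theta p X = 0 →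
      mfderiv (𝓡 (2 * m + 1)) (𝓡 (2 * m + 1)) φ p (S.inducedJ p X) =
        S'.inducedJ (φ p) (mfderiv (𝓡 (2 * m + 1)) (𝓡 (2 * m + 1)) φ p X) := by
    intro p X hX
    have hX' := (comp_theta S' φ p X).symm.trans ((hθ p X).trans hX)
    apply S'.d_injective
    rw [d_inducedJ _ _ _ hX', ← comp_d, ← comp_d, hd, hd, S.d_inducedJ p X hX,
      hΦ.map_J _ _ hX, hφ]
  choose F hF using fun p => exists_normal_isometry (S := S) (S' := S') (φ := φ) p e
    fun v hv => mem_normalSpace_comp hθ hU hi hv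
  refine ⟨F, ?_, fun p X => ?_, hJ, fun p X Y w hX hY => ?_, fun O V hO hV p hp X => ?_,
    fun p => ?_⟩
  · intro O V hO hV
    simp only [hF]
    exact fun q hq => (e.toContinuousLinearEquiv.toContinuousLinearMap.restrictScalars ℝ).contDiff
      |>.contMDiff.contMDiffAt.comp_contMDiffWithinAt q (hV q hq)
  · rw [← comp_theta, hθ]
  · rw [Submodule.coe_inner, Submodule.coe_inner, hF]
    have h := inner_secondFundamentalForm_comp hθ hU hi hsm hX (hJ p Y hY) w.2
    rw [hU0] at h
    simp only [zero_apply, smul_zero, sub_zero, inner_zero_right, mul_zero, add_zero] at h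
    exact h
  · have h := normalConnection_comp hθ hU hi hsm (hV.contMDiffAt (hO.mem_nhds hp)) X
    refine Subtype.ext ?_
    simp only [hF]
    refine Eq.trans ?_ h.symm
    rw [hU0]
    have h0 : S'.normalProj (φ p) ((0 : TangentSpace (𝓡 (2 * m + 1)) p →L[ℝ]
        (CVec n →L[ℂ] CVec n)) X (V p)) = 0 := map_zero _
    rw [h0, Submodule.coe_zero, zero_add]
    rfl
  · obtain ⟨R, hR, hν⟩ := S.exists_reeb p
    have h1 := (S'.comp φ).d_eq_T_add ((hθ p R).trans hR)
    rw [hU, hν, comp_d, comp_apply] at h1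
    refine S'.eq_fundamentalVector _ (R := mfderiv (𝓡 (2 * m + 1)) (𝓡 (2 * m + 1)) φ p R) ?_
    rw [h1, hF]
    rfl

end PseudohermitianSubmanifold

end

theorem theoremA {m n : ℕ} (hm : 1 ≤ m) (hmn : m ≤ n)
    {M : Type*} [TopologicalSpace M] [T2Space M] [SecondCountableTopology M]
    [ChartedSpace (EuclideanSpace ℝ (Fin (2 * m + 1))) M] [IsManifold (𝓡 (2 * m + 1)) ∞ M]
    [SimplyConnectedSpace M]
    {N : Type*} [TopologicalSpace N] [T2Space N] [SecondCountableTopology N]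
    [ChartedSpace (EuclideanSpace ℝ (Fin (2 * m + 1))) N] [IsManifold (𝓡 (2 * m + 1)) ∞ N]
    [SimplyConnectedSpace N]
    (S : PseudohermitianSubmanifold m n M) (S' : PseudohermitianSubmanifold m n N)
    (φ : Diffeomorph (𝓡 (2 * m + 1)) (𝓡 (2 * m + 1)) M N ∞) :
    (∃ F : ∀ p, S.normalSpace p ≃ₗᵢ[ℂ] S'.normalSpace (φ p), PreservesInvariants S S' φ F) ↔
      ∃ Φ : Diffeomorph 𝓘(ℝ, Heis n) 𝓘(ℝ, Heis n) (Heis n) (Heis n) ∞,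
        Heis.IsRigidMotion Φ ∧ ∀ p : M, Φ (S p) = S' (φ p) := by
  constructor
  · rintro ⟨F, hF⟩
    obtain ⟨e, he⟩ := PseudohermitianSubmanifold.exists_constant_isometry hF
    -- The second immersion is pulled back by `φ`, so that both are defined on `M`.
    obtain ⟨b, c, h⟩ := PseudohermitianSubmanifold.exists_rigidMotion (S := S) (S' := S'.comp φ)
      (fun p X => (S'.comp_theta φ p X).trans (hF.contactForm_eq p X)) e he
    exact ⟨Heis.rigidMotion e b c, Heis.isRigidMotion_rigidMotion e b c, h⟩
  · rintro ⟨Φ, hΦ, h⟩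
    exact PseudohermitianSubmanifold.exists_preservesInvariants hΦ h
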